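/- Let $\xi$ be a random variable with values in $\{0,1,2,\dots\}$, $\mathbb{E}\,\xi=1$ and $0<\operatorname{Var}\xi<\infty$. Let $\mathcal{T}$ be the Galton--Watson tree with offspring distribution $\xi$, that is, the random rooted tree that starts from a root and in which every vertex independently has a number of children distributed as $\xi$. For every $n\ge 1$ with $\mathbb{P}(|\mathcal{T}|=n)>0$, let $T_n$ denote $\mathcal{T}$ conditioned on having exactly $n$ vertices. For a rooted tree $\tau$ and $k\ge 0$, let $Z_k(\tau)$ be the number of vertices of $\tau$ at distance $k$ from the root. Then for every real $r>0$ there is a constant $C(r)>0$, depending only on $r$ and the distribution of $\xi$, such that for all $k\ge 0$ and all $n\ge 1$ with $\mathbb{P}(|\mathcal{T}|=n)>0$, $$\mathbb{E}\,\bigl[Z_k(T_n)^r\bigr]\le C(r)\,n^{r/2}.$$ -/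

import Mathlib

open MeasureTheory ProbabilityTheory

namespace GaltonWatson

/-- Rooted plane trees in Ulam-Harris coding. A potential individual is a finite list
`[i₁, …, iₖ]` of natural numbers: the root is `[]`, and the children of the individual `u` are
`u ++ [0], u ++ [1], …`. The function `c` prescribes the number `c u` of children of every
potential individual `u`. Then `IsVertex c [i₁, …, iₖ]` says that this individual exists, that is,
`iⱼ < c [i₁, …, iⱼ₋₁]` for `j = 1, …, k`. -/
def IsVertex : (List ℕ → ℕ) → List ℕ → Prop
  | _, [] => True
  | c, i :: v => i < c [] ∧ IsVertex (fun u => c (i :: u)) v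

/-- The vertex set of the family tree with offspring numbers `c`. -/
def familyTree (c : List ℕ → ℕ) : Set (List ℕ) := {v | IsVertex c v}

/-- The number of vertices of the family tree, possibly infinite. -/
noncomputable def treeSize (c : List ℕ → ℕ) : ℕ∞ := (familyTree c).encard

/-- `Z_k`: the number of vertices of the family tree at distance `k` from the root
(this set is always finite, since every individual has finitely many children). -/
noncomputable def generationSize (k : ℕ) (c : List ℕ → ℕ) : ℕ :=
  {v ∈ familyTree c | v.length = k}.ncard

/-- The law of the Galton-Watson process with offspring distribution `ν`: the offspring numbers
of all potential individuals are independent with law `ν`. Under this measure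
`familyTree` is the Galton-Watson tree. -/
noncomputable def gwLaw (ν : Measure ℕ) [IsProbabilityMeasure ν] : Measure (List ℕ → ℕ) :=
  Measure.infinitePi (fun _ : List ℕ => ν)

/-- The law of the Galton-Watson process conditioned on the tree having `n` vertices (meaningful
when this event has positive probability). Under this measure `familyTree` is the conditioned
Galton-Watson tree `T_n`. -/
noncomputable def condGWLaw (ν : Measure ℕ) [IsProbabilityMeasure ν] (n : ℕ) :
    Measure (List ℕ → ℕ) :=
  ProbabilityTheory.cond (gwLaw ν) {c | treeSize c = (n : ℕ∞)}

end GaltonWatson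

/-! Cut the tree at generation `k`. Given the part before it and `Z_k = z`, the rest is a forest of
`z` independent copies of `𝒯`, so `E[Z_k^s; |𝒯| = n]` is the mean of `Z_k^s · P(z trees have N
vertices in total)` with `N` at most `n` (`map_glue`, `lintegral_generationSize_pow_indicator`).

Let `S_N` be the sum of `N` independent copies of `ξ`. The Otter-Dwass formula
(`natCast_mul_coeff_pow`) turns the forest probability into `(z/N) P(S_N = N - z)`. A Chernoff tilt
combined with Fourier inversion gives `P(S_N = N - z) ≤ C N^(-1/2) exp(-z/√N)`
(`exists_coeff_pow_le`). The exponential absorbs `m + 3` powers of `z` at the price of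
`N^((m+3)/2)`; one factor `z` survives and is integrated by `E Z_k = 1`. Hence `E[Z_k^(m+3); |𝒯| =
n] ≤ K n^(m/2)`, uniformly in `k`.

It remains to divide by `P(|𝒯| = n) = P(S_n = n - 1)/n`, which is at least `c n^(-3/2)` whenever it
is positive, by a local limit theorem that allows for a lattice span `d` (`exists_le_coeff_pow`).
The quotient has order `n^((m+3)/2)`. A real exponent `r` is reached by comparison with a larger
integer exponent. -/

namespace GaltonWatson

/-! ### Generations of a tree and cutting it at generation `k` -/

theorem isVertex_append (c : List ℕ → ℕ) (v u : List ℕ) :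
    IsVertex c (v ++ u) ↔ IsVertex c v ∧ IsVertex (fun w => c (v ++ w)) u := by
  induction v generalizing c with
  | nil => simp [IsVertex]
  | cons i v ih => simp [IsVertex, ih, and_assoc]

theorem isVertex_congr {c c' : List ℕ → ℕ} {v : List ℕ}
    (h : ∀ u : List ℕ, u.length < v.length → c u = c' u) : IsVertex c v ↔ IsVertex c' v := by
  induction v generalizing c c' with
  | nil => simp [IsVertex]
  | cons i v ih =>
    simp only [IsVertex]
    rw [h [] (by simp), ih (c := fun u => c (i :: u)) (c' := fun u => c' (i :: u))]
    intro u hu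
    exact h _ (by simpa using hu)

/-- The set of individuals of generation `k`. -/
def level (k : ℕ) (c : List ℕ → ℕ) : Set (List ℕ) := {v ∈ familyTree c | v.length = k}

theorem mem_level {k : ℕ} {c : List ℕ → ℕ} {v : List ℕ} :
    v ∈ level k c ↔ IsVertex c v ∧ v.length = k := Iff.rfl

theorem generationSize_eq (k : ℕ) (c : List ℕ → ℕ) :
    generationSize k c = (level k c).ncard := rfl

theorem level_zero (c : List ℕ → ℕ) : level 0 c = {[]} := by
  ext v
  simp only [mem_level, List.length_eq_zero_iff, Set.mem_singleton_iff, and_iff_right_iff_imp]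
  rintro rfl
  simp [IsVertex]

theorem level_succ (k : ℕ) (c : List ℕ → ℕ) :
    level (k + 1) c =
      ⋃ i ∈ Finset.range (c []), (List.cons i) '' level k (fun u => c (i :: u)) := by
  ext v
  cases v with
  | nil => simp [mem_level]
  | cons i v =>
    simp only [mem_level, IsVertex, List.length_cons, Nat.add_right_cancel_iff, Finset.mem_range,
      Set.mem_iUnion, Set.mem_image, List.cons.injEq, exists_prop]
    constructor
    · rintro ⟨⟨hi, hv⟩, hl⟩
      exact ⟨i, hi, v, ⟨hv, hl⟩, rfl, rfl⟩
    · rintro ⟨_, hi, _, ⟨hv, hl⟩, rfl, rfl⟩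
      exact ⟨⟨hi, hv⟩, hl⟩

theorem level_finite (k : ℕ) (c : List ℕ → ℕ) : (level k c).Finite := by
  induction k generalizing c with
  | zero => simp [level_zero]
  | succ k ih =>
    rw [level_succ]
    exact (Finset.finite_toSet _).biUnion fun i _ => (ih _).image _

/-- The individuals of the generations before generation `k`. -/
def lower (k : ℕ) (c : List ℕ → ℕ) : Set (List ℕ) := {v ∈ familyTree c | v.length < k}

theorem lower_finite (k : ℕ) (c : List ℕ → ℕ) : (lower k c).Finite := by
  refine ((Finset.range k).finite_toSet.biUnion fun j _ => level_finite j c).subset ?_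
  rintro v ⟨hv, hk⟩
  exact Set.mem_biUnion (by simpa using hk) ⟨hv, rfl⟩

theorem lower_one (c : List ℕ → ℕ) : lower 1 c = {[]} := by
  rw [← level_zero c]
  ext v
  simp [lower, level]

theorem encard_biUnion_finset {ι α : Type*} (s : Finset ι) (t : ι → Set α)
    (h : (s : Set ι).PairwiseDisjoint t) :
    (⋃ i ∈ s, t i).encard = ∑ i ∈ s, (t i).encard := by
  classical
  induction s using Finset.induction_on with
  | empty => simp
  | insert a s ha ih =>
    rw [Finset.set_biUnion_insert, Set.encard_union_eq, Finset.sum_insert ha, ih]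
    · exact h.subset (by simp)
    · rw [Set.disjoint_iUnion₂_right]
      intro i hi
      exact h (by simp) (by simp [hi]) (by rintro rfl; exact ha hi)

theorem natCast_generationSize (k : ℕ) (c : List ℕ → ℕ) :
    (generationSize k c : ℕ∞) = (level k c).encard :=
  (level_finite k c).cast_ncard_eq

theorem generationSize_zero (c : List ℕ → ℕ) : generationSize 0 c = 1 := by
  rw [generationSize_eq, level_zero, Set.ncard_singleton]

theorem generationSize_succ (k : ℕ) (c : List ℕ → ℕ) :
    generationSize (k + 1) c =
      ∑ i ∈ Finset.range (c []), generationSize k (fun u => c (i :: u)) := by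
  have h : (generationSize (k + 1) c : ℕ∞) =
      ((∑ i ∈ Finset.range (c []), generationSize k (fun u => c (i :: u)) : ℕ) : ℕ∞) := by
    rw [natCast_generationSize, level_succ, encard_biUnion_finset]
    · push_cast
      refine Finset.sum_congr rfl fun i _ => ?_
      rw [(List.cons_injective).encard_image, natCast_generationSize]
    · intro i _ j _ hij
      rw [Function.onFun, Set.disjoint_left]
      rintro _ ⟨u, _, rfl⟩ ⟨w, _, h⟩
      exact hij (List.cons.inj h).1.symm
  exact_mod_cast h

theorem generationSize_one (c : List ℕ → ℕ) : generationSize 1 c = c [] := by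
  simp [generationSize_succ, generationSize_zero]

/-- Replace the offspring numbers from generation `k` on: the individual `v` of generation `k`
becomes the root of the tree with offspring numbers `d v`. -/
def glue (k : ℕ) (c : List ℕ → ℕ) (d : List ℕ → List ℕ → ℕ) (u : List ℕ) : ℕ :=
  if u.length < k then c u else d (u.take k) (u.drop k)

theorem isVertex_glue {k : ℕ} (c : List ℕ → ℕ) (d : List ℕ → List ℕ → ℕ) {v : List ℕ}
    (hv : v.length ≤ k) : IsVertex (glue k c d) v ↔ IsVertex c v :=
  isVertex_congr fun u hu => by simp [glue, hu.trans_le hv]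

theorem glue_append (c : List ℕ → ℕ) (d : List ℕ → List ℕ → ℕ) (v u : List ℕ) :
    glue v.length c d (v ++ u) = d v u := by
  simp [glue]

theorem level_glue (k : ℕ) (c : List ℕ → ℕ) (d : List ℕ → List ℕ → ℕ) :
    level k (glue k c d) = level k c := by
  ext v
  simp only [mem_level, and_congr_left_iff]
  exact fun h => isVertex_glue c d h.le

theorem generationSize_glue (k : ℕ) (c : List ℕ → ℕ) (d : List ℕ → List ℕ → ℕ) :
    generationSize k (glue k c d) = generationSize k c := by
  rw [generationSize_eq, level_glue, generationSize_eq]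

theorem familyTree_glue (k : ℕ) (c : List ℕ → ℕ) (d : List ℕ → List ℕ → ℕ) :
    familyTree (glue k c d) = lower k c ∪
      ⋃ v ∈ (level_finite k c).toFinset, (fun u => v ++ u) '' familyTree (d v) := by
  ext w
  simp only [familyTree, lower, Set.mem_ofPred_eq, Set.Finite.mem_toFinset, mem_level, Set.mem_union,
    Set.mem_iUnion, Set.mem_image, exists_prop]
  rcases lt_or_ge w.length k with hw | hw
  · rw [isVertex_glue c d hw.le]
    constructor
    · exact fun h => Or.inl ⟨h, hw⟩
    · rintro (h | ⟨v, ⟨_, hl⟩, u, _, rfl⟩)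
      · exact h.1
      · simp at hw; omega
  · obtain ⟨v, u, rfl, rfl⟩ : ∃ v u, w = v ++ u ∧ v.length = k :=
      ⟨w.take k, w.drop k, by simp, by simp [hw]⟩
    rw [isVertex_append, isVertex_glue c d le_rfl]
    simp only [glue_append]
    constructor
    · exact fun h => Or.inr ⟨v, ⟨h.1, rfl⟩, u, h.2, rfl⟩
    · rintro (h | ⟨v', ⟨hv, hl⟩, u', hu, h⟩)
      · simp at h
      · obtain ⟨rfl, rfl⟩ := List.append_inj h hl
        exact ⟨hv, hu⟩

theorem treeSize_glue (k : ℕ) (c : List ℕ → ℕ) (d : List ℕ → List ℕ → ℕ) :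
    treeSize (glue k c d) =
      ((lower k c).ncard : ℕ∞) + ∑ v ∈ (level_finite k c).toFinset, treeSize (d v) := by
  rw [treeSize, familyTree_glue, Set.encard_union_eq, encard_biUnion_finset,
    (lower_finite k c).cast_ncard_eq]
  · congr 1
    refine Finset.sum_congr rfl fun v _ => ?_
    rw [(List.append_right_injective v).encard_image, treeSize]
  · intro v hv w hw hvw
    rw [Function.onFun, Set.disjoint_left]
    rintro _ ⟨u, _, rfl⟩ ⟨u', _, h⟩
    simp only [Finset.mem_coe, Set.Finite.mem_toFinset, mem_level] at hv hw
    exact hvw (List.append_inj h (hw.2.trans hv.2.symm)).1.symm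
  · simp only [Set.disjoint_iUnion_right, Set.Finite.mem_toFinset, mem_level]
    rintro v ⟨_, hv⟩
    rw [Set.disjoint_left]
    rintro _ ⟨_, hl⟩ ⟨u, _, rfl⟩
    simp at hl; omega

theorem card_level_toFinset (k : ℕ) (c : List ℕ → ℕ) :
    (level_finite k c).toFinset.card = generationSize k c := by
  rw [generationSize_eq, Set.ncard_eq_toFinset_card _ (level_finite k c)]

/-! ### Measurability -/

theorem measurableSet_isVertex (v : List ℕ) : MeasurableSet {c : List ℕ → ℕ | IsVertex c v} := by
  induction v with
  | nil => simp [IsVertex]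
  | cons i v ih =>
    simp only [IsVertex]
    refine MeasurableSet.inter (measurableSet_lt measurable_const (measurable_pi_apply _)) ?_
    have : Measurable fun (c : List ℕ → ℕ) (u : List ℕ) => c (i :: u) := by fun_prop
    exact this ih

theorem measurableSet_setOf_eq_coe {Ω α : Type*} [MeasurableSpace Ω] [Countable α]
    {S : Ω → Set α} (hS : ∀ a, MeasurableSet {ω | a ∈ S ω}) (V : Set α) :
    MeasurableSet {ω | S ω = V} := by
  have : {ω | S ω = V} = ⋂ a, {ω | a ∈ S ω ↔ a ∈ V} := by
    ext ω
    simp [Set.ext_iff]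
  rw [this]
  refine MeasurableSet.iInter fun a => ?_
  by_cases ha : a ∈ V
  · simpa [ha] using hS a
  · simp only [ha, iff_false]
    exact (hS a).compl

theorem measurableSet_treeSize_eq (n : ℕ) :
    MeasurableSet {c : List ℕ → ℕ | treeSize c = (n : ℕ∞)} := by
  have : {c : List ℕ → ℕ | treeSize c = (n : ℕ∞)} =
      ⋃ V : Finset (List ℕ), ⋃ _ : V.card = n, {c | familyTree c = V} := by
    ext c
    simp only [treeSize, Set.mem_ofPred_eq, Set.mem_iUnion, exists_prop]
    constructor
    · intro h
      obtain ⟨V, hV⟩ := (Set.finite_of_encard_eq_coe h).exists_finset_coe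
      refine ⟨V, ?_, hV.symm⟩
      rw [← hV, Set.encard_coe_eq_coe_finsetCard] at h
      exact_mod_cast h
    · rintro ⟨V, hV, h⟩
      rw [h, Set.encard_coe_eq_coe_finsetCard, hV]
  rw [this]
  exact MeasurableSet.iUnion fun V => MeasurableSet.iUnion fun _ =>
    measurableSet_setOf_eq_coe (fun v => measurableSet_isVertex v) _

theorem measurable_generationSize (k : ℕ) : Measurable (generationSize k) := by
  refine measurable_to_countable' fun n => ?_
  have : generationSize k ⁻¹' {n} =
      ⋃ V : Finset (List ℕ), ⋃ _ : V.card = n, {c | level k c = V} := by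
    ext c
    simp only [Set.mem_preimage, Set.mem_singleton_iff, Set.mem_iUnion, Set.mem_ofPred_eq,
      exists_prop, generationSize_eq]
    constructor
    · intro h
      refine ⟨(level_finite k c).toFinset, ?_, by simp⟩
      rw [← h, Set.ncard_eq_toFinset_card _ (level_finite k c)]
    · rintro ⟨V, hV, h⟩
      rw [h, Set.ncard_coe_finset, hV]
  rw [this]
  refine MeasurableSet.iUnion fun V => MeasurableSet.iUnion fun _ =>
    measurableSet_setOf_eq_coe (fun v => ?_) _
  exact (measurableSet_isVertex v).inter (MeasurableSet.const _)

theorem measurable_glue (k : ℕ) :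
    Measurable fun p : (List ℕ → ℕ) × (List ℕ → List ℕ → ℕ) => glue k p.1 p.2 := by
  refine measurable_pi_lambda _ fun u => ?_
  by_cases hu : u.length < k
  · simp only [glue, hu, if_true]; fun_prop
  · simp only [glue, hu, if_false]; fun_prop

/-! ### The branching property and the law of the total size -/

section law

variable (ν : Measure ℕ) [IsProbabilityMeasure ν]

instance : IsProbabilityMeasure (gwLaw ν) := by
  unfold gwLaw; infer_instance

/-- The law of independent Galton-Watson processes indexed by `List ℕ`. -/
noncomputable def forestLaw : Measure (List ℕ → List ℕ → ℕ) :=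
  Measure.infinitePi fun _ : List ℕ => gwLaw ν

instance : IsProbabilityMeasure (forestLaw ν) := by
  unfold forestLaw; infer_instance

/-- Uncurried, the forest is one family of independent variables indexed by pairs; an injective
selection of its coordinates is again independent. -/
theorem forestLaw_map_comp {α : Type*} {f : α → List ℕ × List ℕ} (hf : Function.Injective f) :
    (forestLaw ν).map (fun d a => d (f a).1 (f a).2) = Measure.infinitePi fun _ : α => ν := by
  have h := Measure.infinitePi_map_curry_symm (fun _ : List ℕ => fun _ : List ℕ => ν)
  have h2 := Measure.map_infinitePi_infinitePi_of_inj
    (P := fun _ : List ℕ × List ℕ => ν) hf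
  rw [← h, Measure.map_map (by fun_prop) (by fun_prop)] at h2
  exact h2

/-- The branching property. Each box splits into coordinates of length below `k`, read from `c`, and
the others, read from distinct coordinates of the forest because `u` is determined by its first `k`
letters and the remainder. -/
theorem map_glue (k : ℕ) :
    ((gwLaw ν).prod (forestLaw ν)).map (fun p => glue k p.1 p.2) = gwLaw ν := by
  refine Measure.eq_infinitePi _ fun s t ht => ?_
  rw [Measure.map_apply (measurable_glue k)
    (MeasurableSet.pi (Finset.countable_toSet s) fun i _ => ht i)]
  let f : {u : List ℕ // ¬ u.length < k} → List ℕ × List ℕ := fun u => (u.1.take k, u.1.drop k)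
  have hf : Function.Injective f := by
    intro u w h
    simp only [f, Prod.mk.injEq] at h
    ext1
    rw [← List.take_append_drop k u.1, h.1, h.2, List.take_append_drop]
  have hset : (fun p : (List ℕ → ℕ) × (List ℕ → List ℕ → ℕ) => glue k p.1 p.2) ⁻¹'
        (Set.pi (s : Set (List ℕ)) t) =
      (Set.pi (s.filter fun u => u.length < k : Finset (List ℕ)) t) ×ˢ
      ((fun d a => d (f a).1 (f a).2) ⁻¹'
        Set.pi (s.subtype fun u => ¬ u.length < k : Finset _) fun u => t u.1) := by
    ext ⟨c, d⟩
    simp only [Set.mem_preimage, Set.mem_pi, Finset.mem_coe, Set.mem_prod, Finset.mem_filter,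
      Finset.mem_subtype, Subtype.forall, f]
    constructor
    · intro h
      refine ⟨fun u hu => ?_, fun u hu hus => ?_⟩
      · simpa [glue, hu.2] using h u hu.1
      · simpa only [glue, hu, if_false] using h u hus
    · rintro ⟨h1, h2⟩ u hu
      by_cases hk : u.length < k
      · simpa [glue, hk] using h1 u ⟨hu, hk⟩
      · simpa only [glue, hk, if_false] using h2 u hk hu
  rw [hset, Measure.prod_prod, ← Measure.map_apply (by fun_prop), forestLaw_map_comp ν hf, gwLaw,
    Measure.infinitePi_pi _ (fun i _ => ht i), Measure.infinitePi_pi _ (fun i _ => ht i.1),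
    ← Finset.prod_filter_mul_prod_filter_not s fun u => u.length < k]
  · congr 1
    rw [Finset.prod_subtype_eq_prod_filter (f := fun u => ν (t u))]
  · exact MeasurableSet.pi (Finset.countable_toSet _) fun i _ => ht i.1

theorem lintegral_gwLaw_eq_glue (k : ℕ) {g : (List ℕ → ℕ) → ENNReal} (hg : Measurable g) :
    ∫⁻ c, g c ∂(gwLaw ν) = ∫⁻ c, ∫⁻ d, g (glue k c d) ∂(forestLaw ν) ∂(gwLaw ν) := by
  conv_lhs => rw [← map_glue ν k]
  rw [lintegral_map hg (measurable_glue k),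
    lintegral_prod (fun p : (List ℕ → ℕ) × (List ℕ → List ℕ → ℕ) => g (glue k p.1 p.2))
      (hg.comp (measurable_glue k)).aemeasurable]

/-- The generating function of the size of the Galton-Watson tree. -/
noncomputable def sizeSeries : PowerSeries ENNReal :=
  PowerSeries.mk fun n => gwLaw ν {c | treeSize c = (n : ℕ∞)}

theorem forestLaw_map_eval (v : List ℕ) : (forestLaw ν).map (fun d => d v) = gwLaw ν :=
  Measure.infinitePi_map_eval _ v

/-- Sizes of independent trees add, so their generating functions multiply. Infinite trees carry no
coefficient, hence the series may have total mass below one without harm. -/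
theorem forestLaw_sum_treeSize (V : Finset (List ℕ)) (N : ℕ) :
    forestLaw ν {d | ∑ v ∈ V, treeSize (d v) = (N : ℕ∞)} =
      PowerSeries.coeff N (sizeSeries ν ^ V.card) := by
  classical
  induction V using Finset.induction_on generalizing N with
  | empty =>
    by_cases hN : N = 0
    · simp [hN]
    · have : (0 : ℕ∞) ≠ N := by exact_mod_cast (Ne.symm hN)
      simp [hN, this, PowerSeries.coeff_one]
  | insert v V hv ih =>
    have hset : {d : List ℕ → List ℕ → ℕ | ∑ w ∈ insert v V, treeSize (d w) = (N : ℕ∞)} =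
        ⋃ p ∈ Finset.HasAntidiagonal.antidiagonal N, {d : List ℕ → List ℕ → ℕ | treeSize (d v) = (p.1 : ℕ∞)} ∩
          {d | ∑ w ∈ V, treeSize (d w) = (p.2 : ℕ∞)} := by
      ext d
      simp only [Finset.sum_insert hv, Set.mem_ofPred_eq, Finset.HasAntidiagonal.mem_antidiagonal, Set.mem_iUnion,
        Set.mem_inter_iff, exists_prop, Prod.exists]
      constructor
      · intro h
        have h1 : treeSize (d v) ≠ ⊤ := by
          intro h1; simp [h1] at h
        have h2 : ∑ w ∈ V, treeSize (d w) ≠ ⊤ := by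
          intro h2; simp [h2] at h
        lift treeSize (d v) to ℕ using h1 with a
        lift (∑ w ∈ V, treeSize (d w)) to ℕ using h2 with b
        exact ⟨a, b, by exact_mod_cast h, rfl, rfl⟩
      · rintro ⟨a, b, rfl, h1, h2⟩
        simp [h1, h2]
    have hm1 : ∀ (w : List ℕ) (a : ℕ),
        MeasurableSet {d : List ℕ → List ℕ → ℕ | treeSize (d w) = (a : ℕ∞)} := fun w a =>
      have hw : Measurable fun d : List ℕ → List ℕ → ℕ => d w := measurable_pi_apply w
      hw (measurableSet_treeSize_eq a)
    -- A finite value of the sum forces finite summands, so the event is a countable union over the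
    -- vectors of sizes.
    have hsum : ∀ (W : Finset (List ℕ)) (b : ℕ),
        MeasurableSet {e : W → List ℕ → ℕ | ∑ w, treeSize (e w) = (b : ℕ∞)} := by
      intro W b
      have : {e : W → List ℕ → ℕ | ∑ w, treeSize (e w) = (b : ℕ∞)} =
          ⋃ x : W → ℕ, ⋃ _ : ∑ w, x w = b, ⋂ w, {e | treeSize (e w) = (x w : ℕ∞)} := by
        ext e
        simp only [Set.mem_ofPred_eq, Set.mem_iUnion, Set.mem_iInter, exists_prop]
        constructor
        · intro h
          have hfin : ∀ w, treeSize (e w) ≠ ⊤ := by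
            intro w hw
            have := (ENat.sum_eq_top (s := Finset.univ) (f := fun w => treeSize (e w))).2
              ⟨w, Finset.mem_univ _, hw⟩
            rw [h] at this
            exact ENat.natCast_ne_top b this
          choose x hx using fun w => ENat.ne_top_iff_exists.1 (hfin w)
          refine ⟨x, ?_, fun w => (hx w).symm⟩
          simp only [← hx] at h
          exact_mod_cast h
        · rintro ⟨x, rfl, h⟩
          simp [h]
      rw [this]
      exact MeasurableSet.iUnion fun x => MeasurableSet.iUnion fun _ => MeasurableSet.iInter
        fun w =>
          have hw : Measurable fun e : W → List ℕ → ℕ => e w := measurable_pi_apply w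
          hw (measurableSet_treeSize_eq _)
    have hind : ∀ a b : ℕ, forestLaw ν ({d : List ℕ → List ℕ → ℕ | treeSize (d v) = (a : ℕ∞)} ∩
          {d | ∑ w ∈ V, treeSize (d w) = (b : ℕ∞)}) =
        forestLaw ν {d | treeSize (d v) = (a : ℕ∞)} *
          forestLaw ν {d | ∑ w ∈ V, treeSize (d w) = (b : ℕ∞)} := by
      intro a b
      have hI : iIndepFun (fun (w : List ℕ) (d : List ℕ → List ℕ → ℕ) => d w) (forestLaw ν) :=
        iIndepFun_infinitePi (P := fun _ : List ℕ => gwLaw ν) (X := fun _ ω => ω) (by fun_prop)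
      have h := hI.indepFun_finset {v} V (by simpa using hv) (by fun_prop)
      have h' := h.measure_inter_preimage_eq_mul _ _ (hsum {v} a) (hsum V b)
      have e1 : ∀ W : Finset (List ℕ), ∀ b : ℕ,
          (fun (d : List ℕ → List ℕ → ℕ) (w : W) => d w) ⁻¹'
            {e : W → List ℕ → ℕ | ∑ w, treeSize (e w) = (b : ℕ∞)} =
          {d | ∑ w ∈ W, treeSize (d w) = (b : ℕ∞)} := by
        intro W b
        ext d
        simp only [Set.mem_preimage, Set.mem_ofPred_eq]
        rw [Finset.sum_coe_sort W (fun w => treeSize (d w))]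
      rw [e1, e1] at h'
      simpa using h'
    have hmV : ∀ b : ℕ,
        MeasurableSet {d : List ℕ → List ℕ → ℕ | ∑ w ∈ V, treeSize (d w) = (b : ℕ∞)} := by
      intro b
      have : Measurable fun (d : List ℕ → List ℕ → ℕ) (w : V) => d w := by fun_prop
      have h := this (hsum V b)
      convert h using 1
      ext d
      simp only [Set.mem_preimage, Set.mem_ofPred_eq]
      rw [Finset.sum_coe_sort V (fun w => treeSize (d w))]
    rw [hset, measure_biUnion_finset]
    · rw [Finset.card_insert_of_notMem hv, pow_succ', PowerSeries.coeff_mul]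
      refine Finset.sum_congr rfl fun p _ => ?_
      rw [hind, ih, sizeSeries, PowerSeries.coeff_mk, ← forestLaw_map_eval ν v,
        Measure.map_apply (by fun_prop) (measurableSet_treeSize_eq _)]
      rfl
    · rintro ⟨a, b⟩ _ ⟨a', b'⟩ _ hne
      rw [Function.onFun, Set.disjoint_left]
      rintro d ⟨h1, h2⟩ ⟨h3, h4⟩
      simp only [Set.mem_ofPred_eq] at h1 h2 h3 h4
      rw [h1] at h3
      rw [h2] at h4
      exact hne (Prod.ext (by exact_mod_cast h3) (by exact_mod_cast h4))
    · exact fun p _ => (hm1 v p.1).inter (hmV p.2)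

/-- The vertices before generation `k` are fixed by `c`, and the remaining ones form a forest with
`generationSize k c` roots. The case distinction guards the truncated subtraction. -/
theorem forestLaw_treeSize_glue (k n : ℕ) (c : List ℕ → ℕ) :
    forestLaw ν {d | treeSize (glue k c d) = (n : ℕ∞)} =
      if (lower k c).ncard ≤ n then
        PowerSeries.coeff (n - (lower k c).ncard) (sizeSeries ν ^ generationSize k c) else 0 := by
  simp only [treeSize_glue]
  split_ifs with h
  · rw [← card_level_toFinset, ← forestLaw_sum_treeSize]
    congr 1
    ext d
    simp only [Set.mem_ofPred_eq]
    obtain ⟨m, rfl⟩ := Nat.exists_eq_add_of_le h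
    rw [Nat.add_sub_cancel_left, Nat.cast_add]
    exact (ENat.add_right_injective_of_ne_top (ENat.natCast_ne_top _)).eq_iff
  · convert measure_empty (μ := forestLaw ν)
    ext d
    simp only [Set.mem_ofPred_eq, Set.mem_empty_iff_false, iff_false]
    intro h'
    apply h
    have : ((lower k c).ncard : ℕ∞) ≤ n := h' ▸ le_self_add
    exact_mod_cast this

theorem lintegral_gwLaw_root (g : ℕ → ENNReal) :
    ∫⁻ c, g (c []) ∂(gwLaw ν) = ∑' j, ν {j} * g j := by
  have : ∫⁻ c, g (c []) ∂(gwLaw ν) = ∫⁻ j, g j ∂ν := by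
    have h := lintegral_map (μ := gwLaw ν) (measurable_from_top (f := g))
      (measurable_pi_apply (X := fun _ : List ℕ => ℕ) [])
    rw [← h, gwLaw, Measure.infinitePi_map_eval (fun _ : List ℕ => ν) []]
  rw [this, lintegral_countable']
  exact tsum_congr fun _ => mul_comm _ _

theorem lintegral_generationSize (hmean : ∫⁻ j, (j : ENNReal) ∂ν = 1) (k : ℕ) :
    ∫⁻ c, (generationSize k c : ENNReal) ∂(gwLaw ν) = 1 := by
  have hm : ∀ k, Measurable fun c => (generationSize k c : ENNReal) := fun k =>
    (measurable_from_top (f := fun n : ℕ => (n : ENNReal))).comp (measurable_generationSize k)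
  induction k with
  | zero => simp [generationSize_zero]
  | succ k ih =>
    rw [lintegral_gwLaw_eq_glue ν 1 (hm _)]
    have h1 : ∀ (c : List ℕ → ℕ) (d : List ℕ → List ℕ → ℕ),
        generationSize (k + 1) (glue 1 c d) = ∑ i ∈ Finset.range (c []),
          generationSize k (d [i]) := by
      intro c d
      rw [generationSize_succ]
      simp [glue]
    have h2 : ∀ i : ℕ, ∫⁻ d, (generationSize k (d [i]) : ENNReal) ∂(forestLaw ν) = 1 := by
      intro i
      rw [← ih]
      conv_rhs => rw [← forestLaw_map_eval ν [i]]
      rw [lintegral_map (hm k) (by fun_prop)]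
    have h3 : ∀ c : List ℕ → ℕ,
        ∫⁻ d, (generationSize (k + 1) (glue 1 c d) : ENNReal) ∂(forestLaw ν) = (c [] : ENNReal) := by
      intro c
      simp only [h1, Nat.cast_sum]
      rw [lintegral_finsetSum]
      · simp [h2]
      · exact fun i _ => (hm k).comp (measurable_pi_apply _)
    simp only [h3]
    rw [lintegral_gwLaw_root ν fun j => (j : ENNReal), ← hmean, lintegral_countable']
    exact tsum_congr fun _ => mul_comm _ _

theorem coeff_zero_sizeSeries : PowerSeries.coeff 0 (sizeSeries ν) = 0 := by
  rw [sizeSeries, PowerSeries.coeff_mk]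
  convert measure_empty (μ := gwLaw ν)
  ext c
  simp only [Nat.cast_zero, treeSize, Set.encard_eq_zero, Set.mem_ofPred_eq,
    Set.mem_empty_iff_false, iff_false]
  exact Set.Nonempty.ne_empty ⟨[], trivial⟩

/-- Regrafting at generation `k` leaves `Z_k` unchanged, so only the size event is averaged over the
forest. -/
theorem lintegral_generationSize_pow_indicator (m k n : ℕ) :
    ∫⁻ c in {c | treeSize c = (n : ℕ∞)}, (generationSize k c : ENNReal) ^ m ∂(gwLaw ν) =
      ∫⁻ c, (generationSize k c : ENNReal) ^ m * (if (lower k c).ncard ≤ n then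
        PowerSeries.coeff (n - (lower k c).ncard) (sizeSeries ν ^ generationSize k c) else 0)
          ∂(gwLaw ν) := by
  have hm : Measurable fun c => (generationSize k c : ENNReal) ^ m :=
    (measurable_from_top (f := fun n : ℕ => (n : ENNReal) ^ m)).comp (measurable_generationSize k)
  have hs := measurableSet_treeSize_eq n
  rw [← lintegral_indicator hs, lintegral_gwLaw_eq_glue ν k (hm.indicator hs)]
  refine lintegral_congr fun c => ?_
  rw [← forestLaw_treeSize_glue]
  have hs' : MeasurableSet {d | treeSize (glue k c d) = (n : ℕ∞)} :=
    ((measurable_glue k).comp (measurable_prodMk_left (x := c))) hs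
  rw [← lintegral_indicator_const hs']
  refine lintegral_congr fun d => ?_
  simp only [Set.indicator, Set.mem_ofPred_eq, generationSize_glue]

/-- The functional equation `F = X · Φ(F)` of the size series, with `Φ` the offspring generating
function: the preceding identity at generation one and power zero. -/
theorem coeff_succ_sizeSeries (n : ℕ) :
    PowerSeries.coeff (n + 1) (sizeSeries ν) =
      ∑' j, ν {j} * PowerSeries.coeff n (sizeSeries ν ^ j) := by
  have h := lintegral_generationSize_pow_indicator ν 0 1 (n + 1)
  simp only [pow_zero, one_mul, lower_one, Set.ncard_singleton, generationSize_one,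
    Nat.add_sub_cancel, le_add_iff_nonneg_left, zero_le, if_true, setLIntegral_one] at h
  rw [sizeSeries, PowerSeries.coeff_mk, h]
  exact lintegral_gwLaw_root ν fun j => PowerSeries.coeff n (sizeSeries ν ^ j)

end law

end GaltonWatson

/-! ### The Otter-Dwass formula -/

namespace GaltonWatson

theorem tsum_mul_coeff_X_pow_mul (b : ℕ → ENNReal) (G : PowerSeries ENNReal) (N : ℕ) :
    ∑' j, b j * PowerSeries.coeff N (PowerSeries.X ^ j * G) =
      PowerSeries.coeff N (PowerSeries.mk b * G) := by
  rw [PowerSeries.coeff_mul, Finset.Nat.sum_antidiagonal_eq_sum_range_succ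
    (f := fun i j => PowerSeries.coeff i (PowerSeries.mk b) * PowerSeries.coeff j G),
    tsum_eq_sum (s := Finset.range (N + 1))]
  · refine Finset.sum_congr rfl fun j hj => ?_
    rw [PowerSeries.coeff_X_pow_mul', if_pos (Nat.lt_succ_iff.1 (Finset.mem_range.1 hj)),
      PowerSeries.coeff_mk]
  · intro j hj
    rw [PowerSeries.coeff_X_pow_mul', if_neg, mul_zero]
    simpa using hj

/-- The Otter-Dwass formula, as a form of Lagrange inversion for `F = X * (Φ ∘ F)`. -/
theorem natCast_mul_coeff_pow {a : ℕ → ENNReal} {F : PowerSeries ENNReal}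
    (h0 : PowerSeries.coeff 0 F = 0)
    (hF : ∀ n, PowerSeries.coeff (n + 1) F = ∑' j, a j * PowerSeries.coeff n (F ^ j)) (N z : ℕ) :
    N * PowerSeries.coeff N (F ^ z) =
      z * PowerSeries.coeff N (PowerSeries.X ^ z * PowerSeries.mk a ^ N) := by
  have hconst : ∀ z, PowerSeries.coeff 0 (F ^ (z + 1)) = 0 := by
    intro z
    rw [PowerSeries.coeff_zero_eq_constantCoeff_apply] at h0 ⊢
    simp [h0]
  -- Only one factor of `F ^ (z + 1)` is expanded by the functional equation, which drives an
  -- induction on `N` for all `z` at once.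
  have hrec : ∀ N z, PowerSeries.coeff (N + 1) (F ^ (z + 1)) =
      ∑' j, a j * PowerSeries.coeff N (F ^ (z + j)) := by
    intro N z
    rw [pow_succ', PowerSeries.coeff_mul, Finset.Nat.sum_antidiagonal_succ, h0, zero_mul, zero_add]
    simp only [hF, pow_add, mul_comm (F ^ z), PowerSeries.coeff_mul, Finset.mul_sum]
    rw [Summable.tsum_finsetSum fun _ _ => ENNReal.summable]
    refine Finset.sum_congr rfl fun p _ => ?_
    rw [← ENNReal.tsum_mul_right]
    exact tsum_congr fun j => mul_assoc _ _ _
  induction N generalizing z with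
  | zero => cases z <;> simp [pow_succ]
  | succ N ih =>
    cases z with
    | zero => simp [PowerSeries.coeff_one]
    | succ z =>
      set Φ : PowerSeries ENNReal := PowerSeries.mk a with hΦ
      have hX : PowerSeries.coeff (N + 1) (PowerSeries.X ^ (z + 1) * Φ ^ (N + 1)) =
          PowerSeries.coeff N (PowerSeries.X ^ z * Φ ^ (N + 1)) := by
        rw [pow_succ', mul_assoc, PowerSeries.coeff_succ_X_mul]
      rw [hX, hrec]
      rcases Nat.eq_zero_or_pos N with rfl | hN
      · cases z with
        | zero =>
          rw [tsum_eq_single 0]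
          · simp [hΦ]
          · intro j hj
            obtain ⟨j, rfl⟩ := Nat.exists_eq_succ_of_ne_zero hj
            rw [zero_add, Nat.succ_eq_add_one, hconst, mul_zero]
        | succ z =>
          have : ∀ j, PowerSeries.coeff 0 (F ^ (z + 1 + j)) = 0 := fun j => by
            rw [show z + 1 + j = z + j + 1 by ring, hconst]
          simp only [this, mul_zero, tsum_zero]
          simp [pow_succ]
      -- Multiplying by `N` lets the induction hypothesis act on every `F ^ (z + j)`; this loses
      -- information at `N = 0`, which was therefore treated separately.
      · have hN0 : (N : ENNReal) ≠ 0 := by exact_mod_cast hN.ne'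
        rw [← ENNReal.mul_right_inj hN0 (ENNReal.natCast_ne_top N)]
        -- The weights `z + j` produced by the induction hypothesis are encoded by `zΦ + XΦ'`.
        have hmk : PowerSeries.mk (fun j => a j * (z + j : ℕ)) =
            (z : PowerSeries ENNReal) * Φ + PowerSeries.X * PowerSeries.derivative ENNReal Φ := by
          ext j
          rw [map_add, ← map_natCast (PowerSeries.C (R := ENNReal)), PowerSeries.coeff_C_mul]
          cases j with
          | zero => simp [hΦ, mul_comm]
          | succ j =>
            rw [PowerSeries.coeff_succ_X_mul, PowerSeries.coeff_derivative]
            simp only [hΦ, PowerSeries.coeff_mk]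
            push_cast
            ring
        have hs : (N : ENNReal) * ∑' j, a j * PowerSeries.coeff N (F ^ (z + j)) =
            PowerSeries.coeff N (((z : PowerSeries ENNReal) * Φ + PowerSeries.X * PowerSeries.derivative ENNReal Φ) *
              (PowerSeries.X ^ z * Φ ^ N)) := by
          rw [← hmk, ← tsum_mul_coeff_X_pow_mul, ← ENNReal.tsum_mul_left]
          refine tsum_congr fun j => ?_
          rw [mul_left_comm, ih, ← mul_assoc, pow_add, mul_comm (PowerSeries.X ^ z), mul_assoc (_ ^ j)]
        -- The Leibniz rule for `X^z Φ^(N+1)`, arranged without subtraction because the coefficients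
        -- lie in `ENNReal`. Since `X · d/dX` multiplies the `N`-th coefficient by `N`, the factor
        -- `N z + N = N (z + 1)` appears.
        have hD : ((N + 1 : ℕ) : PowerSeries ENNReal) *
            (((z : PowerSeries ENNReal) * Φ + PowerSeries.X * PowerSeries.derivative ENNReal Φ) *
              (PowerSeries.X ^ z * Φ ^ N)) =
            ((N * z : ℕ) : PowerSeries ENNReal) * (PowerSeries.X ^ z * Φ ^ (N + 1)) +
              PowerSeries.X * PowerSeries.derivative ENNReal (PowerSeries.X ^ z * Φ ^ (N + 1)) := by
          rw [Derivation.leibniz, PowerSeries.derivative_pow, PowerSeries.derivative_pow,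
            PowerSeries.derivative_X]
          simp only [smul_eq_mul, Nat.add_sub_cancel]
          cases z with
          | zero => push_cast; ring
          | succ z => simp only [Nat.add_sub_cancel]; push_cast; ring
        have hXD : ∀ H : PowerSeries ENNReal,
            PowerSeries.coeff N (PowerSeries.X * PowerSeries.derivative ENNReal H) =
              N * PowerSeries.coeff N H := by
          intro H
          obtain ⟨M, rfl⟩ := Nat.exists_eq_succ_of_ne_zero hN.ne'
          rw [Nat.succ_eq_add_one, PowerSeries.coeff_succ_X_mul, PowerSeries.coeff_derivative,
            mul_comm]
          push_cast
          rfl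
        have hC : ∀ (m : ℕ) (H : PowerSeries ENNReal),
            PowerSeries.coeff N ((m : PowerSeries ENNReal) * H) = m * PowerSeries.coeff N H := by
          intro m H
          rw [← map_natCast (PowerSeries.C (R := ENNReal)), PowerSeries.coeff_C_mul]
        rw [mul_left_comm, hs, ← hC, hD, map_add, hC, hXD]
        push_cast
        ring

variable (ν : Measure ℕ)

/-- The generating function of the offspring distribution, over `ℝ`. -/
noncomputable def offspringSeries : PowerSeries ℝ := PowerSeries.mk fun j => ν.real {j}

theorem coeff_offspringSeries_pow_nonneg (N M : ℕ) :
    0 ≤ PowerSeries.coeff M (offspringSeries ν ^ N) := by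
  induction N generalizing M with
  | zero =>
    rw [pow_zero, PowerSeries.coeff_one]
    split_ifs <;> simp
  | succ N ih =>
    rw [pow_succ, PowerSeries.coeff_mul]
    refine Finset.sum_nonneg fun p _ => mul_nonneg (ih _) ?_
    simp [offspringSeries]

variable [IsProbabilityMeasure ν]

/-- Both series are images of one series over `NNReal`, so the identity transfers through ring
homomorphisms. -/
theorem coeff_mk_pow (N M : ℕ) :
    PowerSeries.coeff M ((PowerSeries.mk fun j => ν {j}) ^ N) =
      ENNReal.ofReal (PowerSeries.coeff M (offspringSeries ν ^ N)) := by
  let Ψ : PowerSeries NNReal := PowerSeries.mk fun j => (ν {j}).toNNReal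
  have h1 : (PowerSeries.mk fun j => ν {j}) = PowerSeries.map ENNReal.ofNNRealHom Ψ := by
    ext j
    simp [Ψ]
  have h2 : offspringSeries ν = PowerSeries.map NNReal.toRealHom Ψ := by
    ext j
    simp [Ψ, offspringSeries, Measure.real, ENNReal.toReal]
  rw [h1, h2, ← map_pow, ← map_pow, PowerSeries.coeff_map, PowerSeries.coeff_map]
  simp

theorem natCast_mul_coeff_sizeSeries_pow (N z : ℕ) :
    N * PowerSeries.coeff N (sizeSeries ν ^ z) = z * if z ≤ N then
      ENNReal.ofReal (PowerSeries.coeff (N - z) (offspringSeries ν ^ N)) else 0 := by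
  rw [natCast_mul_coeff_pow (coeff_zero_sizeSeries ν) (coeff_succ_sizeSeries ν),
    PowerSeries.coeff_X_pow_mul', coeff_mk_pow]

end GaltonWatson

/-! ### Fourier inversion and bounds for the generating function -/

namespace GaltonWatson

theorem integral_exp_int_mul {d : ℕ} (hd : 0 < d) (l : ℤ) :
    ∫ t in (-(Real.pi / d))..(Real.pi / d), Complex.exp ((d * l : ℤ) * t * Complex.I) =
      if l = 0 then (2 * Real.pi / d : ℂ) else 0 := by
  have hd' : (d : ℂ) ≠ 0 := by exact_mod_cast hd.ne'
  split_ifs with hl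
  · subst hl
    simp only [mul_zero, Int.cast_zero, zero_mul, Complex.exp_zero,
      intervalIntegral.integral_const, sub_neg_eq_add]
    rw [Complex.real_smul]
    push_cast
    ring
  · have hl' : (l : ℂ) ≠ 0 := by exact_mod_cast hl
    have hc : ((d * l : ℤ) : ℂ) * Complex.I ≠ 0 := by
      push_cast
      exact mul_ne_zero (mul_ne_zero hd' hl') Complex.I_ne_zero
    have h := integral_exp_mul_complex (a := -(Real.pi / d)) (b := Real.pi / d) hc
    simp only [mul_right_comm _ _ Complex.I] at h ⊢
    rw [h, div_eq_zero_iff]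
    left
    rw [sub_eq_zero, Complex.exp_eq_exp_iff_exists_int]
    refine ⟨l, ?_⟩
    push_cast
    field_simp
    ring

/-- Inversion of a Fourier series that is supported on a residue class modulo `d`. -/
theorem integral_fourier_eq {p : ℕ → ℂ} {f : ℝ → ℂ} (hp : Summable fun j => ‖p j‖)
    (hf : ∀ t : ℝ, HasSum (fun j : ℕ => p j * Complex.exp (j * t * Complex.I)) (f t))
    {d : ℕ} (hd : 0 < d) {M : ℕ} (hM : ∀ j, p j ≠ 0 → ∃ l : ℤ, (j : ℤ) - M = d * l) :
    ∫ t in (-(Real.pi / d))..(Real.pi / d), f t * Complex.exp (-(M * t * Complex.I)) =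
      2 * Real.pi / d * p M := by
  have hnorm : ∀ (j : ℕ) (t : ℝ), ‖Complex.exp (j * t * Complex.I)‖ = 1 := fun j t => by
    exact_mod_cast Complex.norm_exp_ofReal_mul_I (j * t)
  have hnorm' : ∀ (t : ℝ), ‖Complex.exp (-(M * t * Complex.I))‖ = 1 := fun t => by
    rw [Complex.exp_neg, norm_inv, hnorm, inv_one]
  have h := intervalIntegral.hasSum_integral_of_dominated_convergence
    (μ := volume) (a := -(Real.pi / d)) (b := Real.pi / d)
    (F := fun j t => p j * Complex.exp (j * t * Complex.I) * Complex.exp (-(M * t * Complex.I)))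
    (f := fun t => f t * Complex.exp (-(M * t * Complex.I)))
    (fun j _ => ‖p j‖) (fun j => by
      refine Continuous.aestronglyMeasurable ?_
      fun_prop)
    (fun j => Filter.Eventually.of_forall fun t _ => by
      rw [norm_mul, norm_mul, hnorm, hnorm', mul_one, mul_one])
    (Filter.Eventually.of_forall fun t _ => hp) (by simp)
    (Filter.Eventually.of_forall fun t _ => (hf t).mul_right _)
  refine h.unique ?_
  have hterm : ∀ j, ∫ t in (-(Real.pi / d))..(Real.pi / d),
      p j * Complex.exp (j * t * Complex.I) * Complex.exp (-(M * t * Complex.I)) =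
      if j = M then 2 * Real.pi / d * p M else 0 := by
    intro j
    by_cases hj : p j = 0
    · split_ifs with h
      · subst h; simp [hj]
      · simp [hj]
    · obtain ⟨l, hl⟩ := hM j hj
      have : ∀ t : ℝ, p j * Complex.exp (j * t * Complex.I) * Complex.exp (-(M * t * Complex.I)) =
          p j * Complex.exp ((d * l : ℤ) * t * Complex.I) := by
        intro t
        rw [mul_assoc, ← Complex.exp_add, ← hl]
        push_cast
        ring_nf
      simp only [this]
      rw [intervalIntegral.integral_const_mul, integral_exp_int_mul hd]
      have hd' : (d : ℤ) ≠ 0 := by exact_mod_cast hd.ne'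
      have hiff : l = 0 ↔ j = M := by
        constructor
        · rintro rfl; omega
        · rintro rfl
          simpa [hd.ne'] using hl
      simp only [hiff]
      split_ifs with h
      · rw [h]; ring
      · simp
  simp only [hterm]
  exact hasSum_ite_eq M _

variable (ν : Measure ℕ)

/-- The generating function of the offspring distribution, as a function of a complex variable. -/
noncomputable def pgf (x : ℂ) : ℂ := ∑' j, (ν.real {j} : ℂ) * x ^ j

theorem coeff_offspringSeries (j : ℕ) :
    PowerSeries.coeff j (offspringSeries ν) = ν.real {j} := PowerSeries.coeff_mk _ _

variable [IsProbabilityMeasure ν]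

theorem hasSum_real_singleton : HasSum (fun j => ν.real {j}) 1 := by
  have h : ∑' j, ν {j} = 1 := by
    simpa using (lintegral_countable' (μ := ν) fun _ : ℕ => 1).symm
  have hs : Summable fun j => ν.real {j} := ENNReal.summable_toReal (by simp [h])
  convert hs.hasSum
  rw [← ENNReal.toReal_one, ← h, ENNReal.tsum_toReal_eq fun j => measure_ne_top _ _]
  rfl

theorem summable_norm_pgf {x : ℂ} (hx : ‖x‖ ≤ 1) :
    Summable fun j => ‖(ν.real {j} : ℂ) * x ^ j‖ := by
  refine Summable.of_nonneg_of_le (fun _ => norm_nonneg _) (fun j => ?_)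
    (hasSum_real_singleton ν).summable
  rw [norm_mul, norm_pow, Complex.norm_real, Real.norm_of_nonneg measureReal_nonneg]
  exact mul_le_of_le_one_right measureReal_nonneg (pow_le_one₀ (norm_nonneg _) hx)

theorem hasSum_pgf_pow (N : ℕ) {x : ℂ} (hx : ‖x‖ ≤ 1) :
    (Summable fun M => ‖((PowerSeries.coeff M (offspringSeries ν ^ N) : ℝ) : ℂ) * x ^ M‖) ∧
    HasSum (fun M => ((PowerSeries.coeff M (offspringSeries ν ^ N) : ℝ) : ℂ) * x ^ M)
      (pgf ν x ^ N) := by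
  induction N with
  | zero =>
    have h : ∀ M, M ≠ 0 → ((PowerSeries.coeff M (offspringSeries ν ^ 0) : ℝ) : ℂ) * x ^ M = 0 := by
      intro M hM
      simp [PowerSeries.coeff_one, hM]
    constructor
    · exact summable_of_ne_finset_zero (s := {0}) fun M hM => by
        rw [h M (by simpa using hM), norm_zero]
    · convert hasSum_single 0 h using 1
      simp
  | succ N ih =>
    have hg := summable_norm_pgf ν hx
    have hco : ∀ M, ∑ p ∈ Finset.HasAntidiagonal.antidiagonal M,
        (((PowerSeries.coeff p.1 (offspringSeries ν ^ N) : ℝ) : ℂ) * x ^ p.1) *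
          ((ν.real {p.2} : ℂ) * x ^ p.2) =
        ((PowerSeries.coeff M (offspringSeries ν ^ (N + 1)) : ℝ) : ℂ) * x ^ M := by
      intro M
      rw [pow_succ, PowerSeries.coeff_mul, Complex.ofReal_sum, Finset.sum_mul]
      refine Finset.sum_congr rfl fun p hp => ?_
      rw [← Finset.HasAntidiagonal.mem_antidiagonal.1 hp, coeff_offspringSeries, pow_add]
      push_cast
      ring
    have hs := summable_norm_sum_mul_antidiagonal_of_summable_norm ih.1 hg
    have ht := tsum_mul_tsum_eq_tsum_sum_antidiagonal_of_summable_norm ih.1 hg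
    simp only [hco] at hs ht
    refine ⟨hs, ?_⟩
    rw [ih.2.tsum_eq] at ht
    rw [show pgf ν x ^ (N + 1) = pgf ν x ^ N * ∑' j, (ν.real {j} : ℂ) * x ^ j from pow_succ _ _, ht]
    exact hs.of_norm.hasSum

theorem integral_pgf_pow {ρ : ℝ} (hρ : 0 < ρ) (hρ1 : ρ ≤ 1) {d : ℕ} (hd : 0 < d) {N M : ℕ}
    (hM : ∀ j, PowerSeries.coeff j (offspringSeries ν ^ N) ≠ 0 → ∃ l : ℤ, (j : ℤ) - M = d * l) :
    ∫ t in (-(Real.pi / d))..(Real.pi / d), pgf ν (ρ * Complex.exp (t * Complex.I)) ^ N *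
        Complex.exp (-(M * t * Complex.I)) =
      2 * Real.pi / d * (((PowerSeries.coeff M (offspringSeries ν ^ N) : ℝ) : ℂ) * ρ ^ M) := by
  have hx : ∀ t : ℝ, ‖(ρ : ℂ) * Complex.exp (t * Complex.I)‖ ≤ 1 := by
    intro t
    rw [norm_mul, Complex.norm_exp_ofReal_mul_I, mul_one, Complex.norm_real,
      Real.norm_of_nonneg hρ.le]
    exact hρ1
  refine integral_fourier_eq
    (p := fun j => ((PowerSeries.coeff j (offspringSeries ν ^ N) : ℝ) : ℂ) * (ρ : ℂ) ^ j) ?_ ?_ hd ?_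
  · refine (hasSum_pgf_pow ν N (x := (ρ : ℂ)) ?_).1
    rw [Complex.norm_real, Real.norm_of_nonneg hρ.le]
    exact hρ1
  · intro t
    convert! (hasSum_pgf_pow ν N (hx t)).2 using 2 with j
    rw [mul_pow, ← Complex.exp_nat_mul]
    ring_nf
  · intro j hj
    refine hM j fun h => hj ?_
    rw [h]; simp

/-- If an atom at `0` and an atom at `b` are out of phase, the generating function decreases. -/
theorem norm_pgf_le {ρ : ℝ} (hρ : 0 < ρ) (hρ1 : ρ ≤ 1) {b : ℕ} (hb : 0 < b) (t : ℝ) :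
    ‖pgf ν (ρ * Complex.exp (t * Complex.I))‖ ≤ (pgf ν ρ).re *
      Real.exp (-(ν.real {0} * ν.real {b} * ρ ^ b * (1 - Real.cos (b * t)))) := by
  set A := ν.real {0}
  set s := ν.real {b} * ρ ^ b with hs
  have hA : 0 ≤ A := measureReal_nonneg
  have hs0 : 0 ≤ s := mul_nonneg measureReal_nonneg (by positivity)
  have hreal : HasSum (fun j => ν.real {j} * ρ ^ j) (pgf ν ρ).re := by
    have h := (summable_norm_pgf ν (x := (ρ : ℂ)) (by
      rw [Complex.norm_real, Real.norm_of_nonneg hρ.le]; exact hρ1)).of_norm.hasSum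
    have := Complex.hasSum_re h
    convert! this using 2 with j
    rw [← Complex.ofReal_pow, ← Complex.ofReal_mul, Complex.ofReal_re]
  have hg1 : (pgf ν ρ).re ≤ 1 :=
    hasSum_le (fun j => mul_le_of_le_one_right measureReal_nonneg (pow_le_one₀ hρ.le hρ1)) hreal
      (hasSum_real_singleton ν)
  have hAs : A + s ≤ (pgf ν ρ).re := by
    have := sum_le_hasSum {0, b} (fun j _ => mul_nonneg measureReal_nonneg (by positivity)) hreal
    rw [Finset.sum_pair hb.ne] at this
    simpa [A, hs] using this
  set x : ℂ := ρ * Complex.exp (t * Complex.I)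
  have hxn : ‖x‖ = ρ := by
    simp only [x]
    rw [norm_mul, Complex.norm_exp_ofReal_mul_I, mul_one, Complex.norm_real,
      Real.norm_of_nonneg hρ.le]
  have hsum := summable_norm_pgf ν (x := x) (hxn.le.trans hρ1)
  have hxb : x ^ b = (ρ ^ b : ℝ) * Complex.exp ((b * t : ℝ) * Complex.I) := by
    simp only [x]
    rw [mul_pow, ← Complex.exp_nat_mul]
    push_cast
    ring_nf
  -- Only the terms `0` and `b` are kept together; all others are bounded by their absolute values.
  have hsplit : ‖pgf ν x‖ ≤
      ‖(A : ℂ) + s * Complex.exp ((b * t : ℝ) * Complex.I)‖ + ((pgf ν ρ).re - (A + s)) := by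
    have h1 := hsum.of_norm.sum_add_tsum_compl (s := {0, b})
    have h2 := hreal.summable.sum_add_tsum_compl (s := {0, b})
    rw [Finset.sum_pair hb.ne] at h1 h2
    rw [hreal.tsum_eq] at h2
    have h3 : ‖∑' j : ↑((({0, b} : Finset ℕ) : Set ℕ)ᶜ), (ν.real {(j : ℕ)} : ℂ) * x ^ (j : ℕ)‖ ≤
        ∑' j : ↑((({0, b} : Finset ℕ) : Set ℕ)ᶜ), ν.real {(j : ℕ)} * ρ ^ (j : ℕ) := by
      refine (norm_tsum_le_tsum_norm (hsum.subtype _)).trans_eq (tsum_congr fun j => ?_)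
      rw [norm_mul, norm_pow, hxn, Complex.norm_real, Real.norm_of_nonneg measureReal_nonneg]
    rw [pgf, ← h1]
    refine (norm_add_le _ _).trans (add_le_add (le_of_eq ?_) (h3.trans_eq ?_))
    · rw [hxb]
      congr 1
      simp only [A, hs]
      push_cast
      ring
    · rw [← h2]
      simp only [A, hs]
      ring
  have hnorm : ‖(A : ℂ) + s * Complex.exp ((b * t : ℝ) * Complex.I)‖ ^ 2 =
      (A + s) ^ 2 - 2 * A * s * (1 - Real.cos (b * t)) := by
    rw [Complex.sq_norm, Complex.normSq_apply, Complex.add_re, Complex.add_im,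
      Complex.re_ofReal_mul, Complex.im_ofReal_mul, Complex.exp_ofReal_mul_I_re,
      Complex.exp_ofReal_mul_I_im, Complex.ofReal_re, Complex.ofReal_im]
    have := Real.sin_sq_add_cos_sq (b * t)
    linear_combination s ^ 2 * this
  set y := 1 - Real.cos (b * t) with hy
  have hy0 : 0 ≤ y := sub_nonneg.2 (Real.cos_le_one _)
  have hAsy : 0 ≤ A * s * y := by positivity
  -- Squaring the right side gives at least `(A + s)^2 - 2Asy(A + s)`, and `A + s ≤ 1`.
  have hle : ‖(A : ℂ) + s * Complex.exp ((b * t : ℝ) * Complex.I)‖ ≤ A + s - A * s * y := by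
    have hy2 : y ≤ 2 := by rw [hy]; linarith [Real.neg_one_le_cos (b * t)]
    refine abs_le_of_sq_le_sq' ?_ ?_ |>.2
    · rw [hnorm]
      nlinarith [mul_nonneg hAsy (sub_nonneg.2 (hAs.trans hg1)), sq_nonneg (A * s * y)]
    · nlinarith [mul_nonneg hA hs0, mul_nonneg (mul_nonneg hA hs0) (sub_nonneg.2 hy2),
        sq_nonneg (A - s)]
  have hg0 : 0 ≤ (pgf ν ρ).re := (add_nonneg hA hs0).trans hAs
  calc ‖pgf ν x‖ ≤ (pgf ν ρ).re - A * s * y := by linarith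
    _ ≤ (pgf ν ρ).re * (1 - A * s * y) := by nlinarith
    _ ≤ (pgf ν ρ).re * Real.exp (-(A * s * y)) := by
        refine mul_le_mul_of_nonneg_left ?_ hg0
        linarith [Real.add_one_le_exp (-(A * s * y))]
    _ = _ := by rw [hs, ← mul_assoc A]

theorem continuous_pgf_circle : Continuous fun t : ℝ => pgf ν (Complex.exp (t * Complex.I)) := by
  refine continuous_tsum (u := fun j => ν.real {j}) (fun j => by fun_prop)
    (hasSum_real_singleton ν).summable fun j t => ?_
  rw [norm_mul, norm_pow, Complex.norm_exp_ofReal_mul_I, one_pow, mul_one, Complex.norm_real,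
    Real.norm_of_nonneg measureReal_nonneg]

end GaltonWatson

/-! ### Upper bound for the point probabilities of `S_N` -/

namespace GaltonWatson

theorem integral_exp_neg_mul_one_sub_cos_le {K : ℝ} (hK : 0 < K) {b : ℕ} (hb : 0 < b) :
    ∫ t in (-Real.pi)..Real.pi, Real.exp (-(K * (1 - Real.cos (b * t)))) ≤
      √(Real.pi / (2 / Real.pi ^ 2 * K)) := by
  have hb' : (b : ℝ) ≠ 0 := by exact_mod_cast hb.ne'
  set f : ℝ → ℝ := fun u => Real.exp (-(K * (1 - Real.cos u))) with hf
  have hfc : Continuous f := by fun_prop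
  have hper : Function.Periodic f (2 * Real.pi) := fun u => by simp [hf]
  -- The scaled interval covers exactly `b` periods, and the Jacobian `1/b` compensates for this.
  have h1 : ∫ t in (-Real.pi)..Real.pi, f (b * t) = ∫ u in (-Real.pi)..Real.pi, f u := by
    rw [intervalIntegral.integral_comp_mul_left _ hb']
    have h := hper.intervalIntegral_add_zsmul_eq b (b * -Real.pi)
      (fun _ _ => hfc.intervalIntegrable _ _)
    have e1 : (b : ℝ) * -Real.pi + (b : ℤ) • (2 * Real.pi) = b * Real.pi := by
      simp only [zsmul_eq_mul, Int.cast_natCast]; ring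
    rw [e1, hper.intervalIntegral_add_eq _ (-Real.pi)] at h
    rw [h]
    have e2 : -Real.pi + 2 * Real.pi = Real.pi := by ring
    rw [e2, smul_eq_mul, zsmul_eq_mul, Int.cast_natCast, inv_mul_cancel_left₀ hb']
  change ∫ t in (-Real.pi)..Real.pi, f (b * t) ≤ _
  rw [h1, ← integral_gaussian]
  have hint : Integrable fun u : ℝ => Real.exp (-(2 / Real.pi ^ 2 * K) * u ^ 2) :=
    integrable_exp_neg_mul_sq (by positivity)
  have hpi : -Real.pi ≤ Real.pi := by linarith [Real.pi_pos]
  calc ∫ u in (-Real.pi)..Real.pi, f u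
      ≤ ∫ u in (-Real.pi)..Real.pi, Real.exp (-(2 / Real.pi ^ 2 * K) * u ^ 2) := by
        refine intervalIntegral.integral_mono_on hpi (hfc.intervalIntegrable _ _)
          hint.intervalIntegrable fun u hu => Real.exp_le_exp.2 ?_
        have := Real.cos_le_one_sub_mul_cos_sq (x := u) (abs_le.2 hu)
        nlinarith
    _ ≤ _ := by
        rw [intervalIntegral.integral_of_le hpi]
        exact setIntegral_le_integral hint (Filter.Eventually.of_forall fun u => (Real.exp_pos _).le)

/-- Because `(1 + x + x²/2)(1 - x + x²/2) = 1 + x⁴/4 ≥ 1`. -/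
theorem exp_neg_le_quadratic {x : ℝ} (hx : 0 ≤ x) : Real.exp (-x) ≤ 1 - x + x ^ 2 / 2 := by
  rw [Real.exp_neg]
  have h := Real.quadratic_le_exp_of_nonneg hx
  rw [inv_le_comm₀ (Real.exp_pos x) (by nlinarith [sq_nonneg (x - 1)])]
  refine le_trans ?_ h
  rw [inv_le_iff_one_le_mul₀ (by nlinarith [sq_nonneg (x - 1)])]
  nlinarith [sq_nonneg (x ^ 2)]

theorem exists_pos_atom (ν : Measure ℕ) (hint : Integrable (fun m : ℕ => (m : ℝ)) ν)
    (hmean : ∫ m, (m : ℝ) ∂ν = 1) : ∃ b : ℕ, 0 < b ∧ 0 < ν.real {b} := by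
  by_contra! h
  rw [integral_countable hint] at hmean
  have : ∀ j : ℕ, ν.real {j} • (j : ℝ) = 0 := by
    intro j
    rcases Nat.eq_zero_or_pos j with rfl | hj
    · simp
    · rw [le_antisymm (h j hj) measureReal_nonneg, zero_smul]
  rw [tsum_congr this, tsum_zero] at hmean
  exact zero_ne_one hmean

section

variable (ν : Measure ℕ) [IsProbabilityMeasure ν]

theorem pgf_eq_integral {x : ℂ} (hx : ‖x‖ ≤ 1) : pgf ν x = ∫ j, x ^ j ∂ν := by
  rw [integral_countable]
  · simp [pgf]
  · refine Integrable.of_bound (by fun_prop) 1 (Filter.Eventually.of_forall fun j => ?_)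
    rw [norm_pow]
    exact pow_le_one₀ (norm_nonneg _) hx

theorem pgf_exp_neg_re_le (hL2 : MemLp (fun m : ℕ => (m : ℝ)) 2 ν)
    (hmean : ∫ m, (m : ℝ) ∂ν = 1) {θ : ℝ} (hθ : 0 ≤ θ) :
    (pgf ν (Real.exp (-θ) : ℝ)).re ≤
      Real.exp (-θ + θ ^ 2 * ((∫ m, (m : ℝ) ^ 2 ∂ν) / 2)) := by
  have h1 : Integrable (fun m : ℕ => (m : ℝ)) ν := hL2.integrable (by norm_num)
  have h2 : Integrable (fun m : ℕ => (m : ℝ) ^ 2) ν := hL2.integrable_sq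
  have hρ : Real.exp (-θ) ≤ 1 := Real.exp_le_one_iff.2 (by linarith)
  have hre : (pgf ν (Real.exp (-θ) : ℝ)).re = ∫ m : ℕ, Real.exp (-(θ * m)) ∂ν := by
    rw [pgf_eq_integral ν (by
      rw [Complex.norm_real, Real.norm_of_nonneg (Real.exp_pos _).le]; exact hρ)]
    have : ∀ j : ℕ, ((Real.exp (-θ) : ℝ) : ℂ) ^ j = ((Real.exp (-(θ * j)) : ℝ) : ℂ) := by
      intro j
      rw [← Complex.ofReal_pow, ← Real.exp_nat_mul]
      congr 2
      ring
    simp only [this]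
    rw [integral_complex_ofReal, Complex.ofReal_re]
  have hsub : Integrable (fun m : ℕ => 1 - θ * (m : ℝ)) ν :=
    (integrable_const _).sub (h1.const_mul _)
  have h3 : Integrable (fun m : ℕ => 1 - θ * (m : ℝ) + θ ^ 2 / 2 * (m : ℝ) ^ 2) ν :=
    hsub.add (h2.const_mul _)
  rw [hre]
  calc ∫ m : ℕ, Real.exp (-(θ * m)) ∂ν
      ≤ ∫ m : ℕ, (1 - θ * (m : ℝ) + θ ^ 2 / 2 * (m : ℝ) ^ 2) ∂ν := by
        refine integral_mono_of_nonneg (Filter.Eventually.of_forall fun m => (Real.exp_pos _).le) h3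
          (Filter.Eventually.of_forall fun m => ?_)
        have := exp_neg_le_quadratic (x := θ * m) (by positivity)
        dsimp only
        linarith
    _ = 1 - θ + θ ^ 2 * ((∫ m, (m : ℝ) ^ 2 ∂ν) / 2) := by
        rw [integral_add hsub (h2.const_mul _),
          integral_sub (integrable_const _) (h1.const_mul _), integral_const_mul,
          integral_const_mul, hmean]
        simp
        ring
    _ ≤ _ := by
        have := Real.add_one_le_exp (-θ + θ ^ 2 * ((∫ m, (m : ℝ) ^ 2 ∂ν) / 2))
        linarith

/-- Without an atom at zero, `ξ ≥ 1` almost surely; mean one then forces `ξ = 1`, which has no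
variance. -/
theorem zero_atom_pos (hL2 : MemLp (fun m : ℕ => (m : ℝ)) 2 ν)
    (hmean : ∫ m, (m : ℝ) ∂ν = 1) (hvar : 0 < variance (fun m : ℕ => (m : ℝ)) ν) :
    0 < ν.real {0} := by
  have hint : Integrable (fun m : ℕ => (m : ℝ)) ν := hL2.integrable (by norm_num)
  by_contra h
  have h0 : ν {0} = 0 := by
    have := le_antisymm (not_lt.1 h) measureReal_nonneg
    rwa [measureReal_eq_zero_iff] at this
  have hae : ∀ᵐ m ∂ν, m ≠ 0 := by
    rw [ae_iff]; simpa using h0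
  have hnn : 0 ≤ᵐ[ν] fun m : ℕ => (m : ℝ) - 1 := by
    filter_upwards [hae] with m hm
    have : (1 : ℝ) ≤ m := by exact_mod_cast Nat.one_le_iff_ne_zero.2 hm
    simpa using this
  have hz := (integral_eq_zero_iff_of_nonneg_ae hnn (hint.sub (integrable_const 1))).1 (by
    rw [integral_sub hint (integrable_const _), hmean]; simp)
  rw [variance_eq_integral hL2.aestronglyMeasurable.aemeasurable, hmean] at hvar
  refine hvar.ne' (integral_eq_zero_of_ae ?_)
  filter_upwards [hz] with m hm
  simp only [Pi.zero_apply] at hm ⊢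
  rw [hm]; simp

/-- Fourier inversion on a circle of radius `ρ < 1`: the radius supplies the exponential factor, and
the loss of modulus along the circle supplies `N^(-1/2)`. Periodicity is harmless for an upper
bound, since two atoms `0` and `b` already make the integral small. -/
theorem exists_coeff_pow_le (hL2 : MemLp (fun m : ℕ => (m : ℝ)) 2 ν)
    (hmean : ∫ m, (m : ℝ) ∂ν = 1) (hvar : 0 < variance (fun m : ℕ => (m : ℝ)) ν) :
    ∃ C : ℝ, 0 < C ∧ ∀ N M : ℕ, 1 ≤ N →
      PowerSeries.coeff M (offspringSeries ν ^ N) ≤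
        C / √N * Real.exp (-((N - M) / √N)) := by
  obtain ⟨b, hb, hνb⟩ := exists_pos_atom ν (hL2.integrable (by norm_num)) hmean
  have hν0 := zero_atom_pos ν hL2 hmean hvar
  set κ := (∫ m, (m : ℝ) ^ 2 ∂ν) / 2
  set c := ν.real {0} * ν.real {b} * Real.exp (-b) with hc
  have hc0 : 0 < c := by positivity
  set D := √(Real.pi / (2 / Real.pi ^ 2 * c)) with hD
  have hD0 : 0 < D := Real.sqrt_pos.2 (by positivity)
  refine ⟨Real.exp κ * D / (2 * Real.pi), by positivity, fun N M hN => ?_⟩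
  have hN0 : (0 : ℝ) < N := by exact_mod_cast hN
  have hsN : 0 < √(N : ℝ) := Real.sqrt_pos.2 hN0
  -- With this tilt `N θ² = 1`, so the second moment costs only the constant factor `exp κ`;
  -- moreover `ρ ^ b` stays above `exp (-b)`.
  set θ := (√(N : ℝ))⁻¹ with hθ
  have hθ0 : 0 < θ := inv_pos.2 hsN
  have hθ1 : θ ≤ 1 := inv_le_one_of_one_le₀ (by
    rw [Real.one_le_sqrt]; exact_mod_cast hN)
  set ρ := Real.exp (-θ) with hρ
  have hρ0 : 0 < ρ := Real.exp_pos _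
  have hρ1 : ρ ≤ 1 := Real.exp_le_one_iff.2 (by linarith)
  set g := (pgf ν (ρ : ℂ)).re
  have hρb : Real.exp (-b) ≤ ρ ^ b := by
    rw [hρ, ← Real.exp_nat_mul, Real.exp_le_exp]
    have : (0 : ℝ) ≤ b := by positivity
    nlinarith
  have hNθ : N * θ ^ 2 = 1 := by
    rw [hθ, inv_pow, Real.sq_sqrt hN0.le, mul_inv_cancel₀ hN0.ne']
  have hg0 : 0 ≤ g := by
    have h := (norm_nonneg _).trans (norm_pgf_le ν hρ0 hρ1 hb 0)
    exact nonneg_of_mul_nonneg_left h (Real.exp_pos _)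
  have hgN : g ^ N ≤ Real.exp (-(N * θ) + κ) := by
    calc g ^ N ≤ Real.exp (-θ + θ ^ 2 * κ) ^ N :=
          pow_le_pow_left₀ hg0 (pgf_exp_neg_re_le ν hL2 hmean hθ0.le) N
      _ = _ := by
          rw [← Real.exp_nat_mul]
          congr 1
          linear_combination κ * hNθ
  have hbound : ∀ t : ℝ, ‖pgf ν (ρ * Complex.exp (t * Complex.I)) ^ N *
      Complex.exp (-(M * t * Complex.I))‖ ≤
      g ^ N * Real.exp (-(N * c * (1 - Real.cos (b * t)))) := by
    intro t
    have h1 : ‖Complex.exp (-(M * t * Complex.I))‖ = 1 := by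
      rw [Complex.exp_neg, norm_inv, inv_eq_one]
      exact_mod_cast Complex.norm_exp_ofReal_mul_I (M * t)
    rw [norm_mul, h1, mul_one, norm_pow]
    have hcos : 0 ≤ 1 - Real.cos (b * t) := sub_nonneg.2 (Real.cos_le_one _)
    calc _ ≤ (g * Real.exp (-(ν.real {0} * ν.real {b} * ρ ^ b * (1 - Real.cos (b * t))))) ^ N :=
          pow_le_pow_left₀ (norm_nonneg _) (norm_pgf_le ν hρ0 hρ1 hb t) N
      _ ≤ (g * Real.exp (-(c * (1 - Real.cos (b * t))))) ^ N := by
          gcongr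
          exact mul_le_mul_of_nonneg_left hρb (by positivity)
      _ = _ := by
          rw [mul_pow, ← Real.exp_nat_mul]
          congr 2
          ring
  have hpi : -Real.pi ≤ Real.pi := by linarith [Real.pi_pos]
  have hint := integral_pgf_pow ν hρ0 hρ1 (d := 1) one_pos (N := N) (M := M)
    (fun j _ => ⟨(j : ℤ) - M, by simp⟩)
  simp only [Nat.cast_one, div_one] at hint
  have hcoef : 2 * Real.pi * (PowerSeries.coeff M (offspringSeries ν ^ N) * ρ ^ M) ≤
      g ^ N * (D * θ) := by
    have h1 := intervalIntegral.norm_integral_le_of_norm_le hpi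
      (Filter.Eventually.of_forall fun t _ => hbound t)
      (Continuous.intervalIntegrable (by fun_prop) (μ := volume) _ _)
    rw [hint, intervalIntegral.integral_const_mul] at h1
    have h2 := integral_exp_neg_mul_one_sub_cos_le (K := N * c) (by positivity) hb
    have h3 : √(Real.pi / (2 / Real.pi ^ 2 * (N * c))) = D * θ := by
      rw [hD, hθ, ← Real.sqrt_inv, ← Real.sqrt_mul (by positivity)]
      congr 1
      field_simp
    rw [h3] at h2
    refine le_trans (le_of_eq ?_) (h1.trans (mul_le_mul_of_nonneg_left h2 (by positivity)))
    have : (2 * Real.pi * (((PowerSeries.coeff M (offspringSeries ν ^ N) : ℝ) : ℂ) * ρ ^ M)) =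
        ((2 * Real.pi * (PowerSeries.coeff M (offspringSeries ν ^ N) * ρ ^ M) : ℝ) : ℂ) := by
      push_cast; ring
    rw [this, Complex.norm_real, Real.norm_of_nonneg]
    have := coeff_offspringSeries_pow_nonneg ν N M
    positivity
  have hρM : ρ ^ M = Real.exp (-(M * θ)) := by
    rw [hρ, ← Real.exp_nat_mul]
    congr 1
    ring
  have hfin : PowerSeries.coeff M (offspringSeries ν ^ N) ≤
      g ^ N * (D * θ) / (2 * Real.pi) * Real.exp (M * θ) := by
    rw [hρM, Real.exp_neg] at hcoef
    have he := Real.exp_pos (M * θ)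
    rw [← mul_assoc, ← div_eq_mul_inv, div_le_iff₀ he] at hcoef
    rw [div_mul_eq_mul_div, le_div_iff₀ (by positivity)]
    linarith
  refine hfin.trans ?_
  calc g ^ N * (D * θ) / (2 * Real.pi) * Real.exp (M * θ)
      ≤ Real.exp (-(N * θ) + κ) * (D * θ) / (2 * Real.pi) * Real.exp (M * θ) := by gcongr
    _ = Real.exp κ * D / (2 * Real.pi) * θ * (Real.exp (-(N * θ)) * Real.exp (M * θ)) := by
        rw [Real.exp_add]; ring
    _ = _ := by
        rw [← Real.exp_add, hθ, ← div_eq_mul_inv]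
        congr 2
        field_simp
        ring

end

end GaltonWatson

/-! ### Lower bound for the point probabilities, with lattice span -/

namespace GaltonWatson

/-- The support of `ν` generates the subgroup `dℤ`. -/
theorem exists_span (ν : Measure ℕ) {b : ℕ} (hb : 0 < b) (hνb : ν.real {b} ≠ 0) :
    ∃ d : ℕ, 0 < d ∧ (∀ j, ν.real {j} ≠ 0 → d ∣ j) ∧
      ∀ t : ℝ, (∀ j : ℕ, ν.real {j} ≠ 0 → Real.cos (j * t) = 1) → Real.cos (d * t) = 1 := by
  obtain ⟨a, ha⟩ := Int.subgroup_cyclic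
    (AddSubgroup.closure {m : ℤ | ∃ j : ℕ, m = j ∧ ν.real {j} ≠ 0})
  have hdvd : ∀ j : ℕ, ν.real {j} ≠ 0 → a ∣ j := by
    intro j hj
    have : (j : ℤ) ∈ AddSubgroup.closure {m : ℤ | ∃ j : ℕ, m = j ∧ ν.real {j} ≠ 0} :=
      AddSubgroup.subset_closure ⟨j, rfl, hj⟩
    rw [ha, AddSubgroup.mem_closure_singleton] at this
    obtain ⟨k, hk⟩ := this
    exact ⟨k, by rw [← hk, smul_eq_mul, mul_comm]⟩
  refine ⟨a.natAbs, ?_, fun j hj => ?_, fun t ht => ?_⟩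
  · rw [Int.natAbs_pos]
    rintro rfl
    have := hdvd b hνb
    rw [zero_dvd_iff] at this
    exact hb.ne' (by exact_mod_cast this)
  · have := Int.natAbs_dvd_natAbs.2 (hdvd j hj)
    simpa using this
  -- The integers `m` with `m t ∈ 2πℤ` form a subgroup; it contains the support, hence the
  -- generator.
  · have hle : AddSubgroup.closure {m : ℤ | ∃ j : ℕ, m = j ∧ ν.real {j} ≠ 0} ≤
        (AddSubgroup.zmultiples (2 * Real.pi)).comap
          ((AddMonoidHom.mulRight t).comp (Int.castAddHom ℝ)) := by
      rw [AddSubgroup.closure_le]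
      rintro _ ⟨j, rfl, hj⟩
      obtain ⟨n, hn⟩ := (Real.cos_eq_one_iff _).1 (ht j hj)
      simp only [AddSubgroup.coe_comap, Set.mem_preimage, SetLike.mem_coe,
        AddSubgroup.mem_zmultiples_iff]
      exact ⟨n, by simpa using hn⟩
    have hmem : (a : ℤ) ∈ AddSubgroup.closure {m : ℤ | ∃ j : ℕ, m = j ∧ ν.real {j} ≠ 0} := by
      rw [ha]
      exact AddSubgroup.subset_closure rfl
    have := hle hmem
    rw [AddSubgroup.mem_comap, AddSubgroup.mem_zmultiples_iff] at this
    obtain ⟨n, hn⟩ := this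
    have h1 : Real.cos (a * t) = 1 := (Real.cos_eq_one_iff _).2 ⟨n, by simpa using hn⟩
    rcases Int.eq_nat_or_neg a with ⟨m, hm | hm⟩
    · rw [hm] at h1 ⊢
      simpa using h1
    · rw [hm] at h1 ⊢
      simpa using h1

theorem dvd_of_coeff_pow_ne_zero {R : Type*} [CommSemiring R] {A : PowerSeries R} {d : ℕ}
    (hA : ∀ j, PowerSeries.coeff j A ≠ 0 → d ∣ j) {N j : ℕ}
    (hj : PowerSeries.coeff j (A ^ N) ≠ 0) : d ∣ j := by
  induction N generalizing j with
  | zero =>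
    rw [pow_zero, PowerSeries.coeff_one] at hj
    have : j = 0 := by by_contra h; simp [h] at hj
    simp [this]
  | succ N ih =>
    rw [pow_succ, PowerSeries.coeff_mul] at hj
    obtain ⟨p, hp, hne⟩ := Finset.exists_ne_zero_of_sum_ne_zero hj
    rw [← Finset.HasAntidiagonal.mem_antidiagonal.1 hp]
    exact dvd_add (ih (left_ne_zero_of_mul hne)) (hA _ (right_ne_zero_of_mul hne))

theorem exists_pos_le_of_pos (f : ℕ → ℝ) (n₀ : ℕ) :
    ∃ c : ℝ, 0 < c ∧ ∀ n < n₀, 0 < f n → c ≤ f n := by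
  induction n₀ with
  | zero => exact ⟨1, one_pos, fun n hn => absurd hn (Nat.not_lt_zero n)⟩
  | succ n₀ ih =>
    obtain ⟨c, hc, h⟩ := ih
    by_cases h0 : 0 < f n₀
    · refine ⟨min c (f n₀), lt_min hc h0, fun n hn hf => ?_⟩
      rcases Nat.lt_succ_iff_lt_or_eq.1 hn with hn | rfl
      · exact (min_le_left _ _).trans (h n hn hf)
      · exact min_le_right _ _
    · refine ⟨c, hc, fun n hn hf => ?_⟩
      rcases Nat.lt_succ_iff_lt_or_eq.1 hn with hn | rfl
      · exact h n hn hf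
      · exact absurd hf h0

variable (ν : Measure ℕ) [IsProbabilityMeasure ν]

theorem norm_pgf_circle_le {b : ℕ} (hb : 0 < b) (t : ℝ) :
    ‖pgf ν (Complex.exp (t * Complex.I))‖ ≤
      Real.exp (-(ν.real {0} * ν.real {b} * (1 - Real.cos (b * t)))) := by
  have h := norm_pgf_le ν one_pos le_rfl hb t
  have h1 : pgf ν ((1 : ℝ) : ℂ) = 1 := by
    rw [pgf_eq_integral ν (by simp)]
    simp
  rw [h1, one_pow, mul_one, Complex.ofReal_one, one_mul, Complex.one_re, one_mul] at h
  exact h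

/-- Near `0` the pair of atoms `0`, `b` gives Gaussian decay; elsewhere on `[-π/d, π/d]` the modulus
is bounded away from one by compactness. -/
theorem exists_norm_pgf_circle_le (h0 : 0 < ν.real {0}) {b : ℕ} (hb : 0 < b)
    (hνb : 0 < ν.real {b}) {d : ℕ} (hd : 0 < d)
    (hspan : ∀ t : ℝ, (∀ j : ℕ, ν.real {j} ≠ 0 → Real.cos (j * t) = 1) → Real.cos (d * t) = 1) :
    ∃ c : ℝ, 0 < c ∧ ∀ t : ℝ, |t| ≤ Real.pi / d →
      ‖pgf ν (Complex.exp (t * Complex.I))‖ ≤ Real.exp (-(c * t ^ 2)) := by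
  have hbR : (0 : ℝ) < b := by exact_mod_cast hb
  have hdR : (0 : ℝ) < d := by exact_mod_cast hd
  have hpi := Real.pi_pos
  -- Modulus one puts every atom in phase with the atom at `0`, hence `cos (d t) = 1`, which for `|d
  -- t| ≤ π` leaves only `t = 0`.
  have hlt : ∀ t : ℝ, t ≠ 0 → |t| ≤ Real.pi / d → ‖pgf ν (Complex.exp (t * Complex.I))‖ < 1 := by
    intro t ht0 ht
    by_contra! hge
    have hcos : ∀ j : ℕ, ν.real {j} ≠ 0 → Real.cos (j * t) = 1 := by
      intro j hj
      rcases Nat.eq_zero_or_pos j with rfl | hjp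
      · simp
      have hj' : 0 < ν.real {j} := lt_of_le_of_ne measureReal_nonneg hj.symm
      have h1 := hge.trans (norm_pgf_circle_le ν hjp t)
      rw [Real.one_le_exp_iff, neg_nonneg] at h1
      have h2 := nonpos_of_mul_nonpos_right h1 (mul_pos h0 hj')
      linarith [Real.cos_le_one (j * t)]
    have h1 := hspan t hcos
    rw [le_div_iff₀ hdR] at ht
    have h2 : |d * t| ≤ Real.pi := by
      rw [abs_mul, abs_of_pos hdR]; linarith
    have h3 := Real.cos_le_one_sub_mul_cos_sq h2
    rw [h1] at h3
    have : 0 < 2 / Real.pi ^ 2 * (d * t) ^ 2 := by positivity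
    linarith
  set c₁ := ν.real {0} * ν.real {b} * (2 / Real.pi ^ 2 * b ^ 2) with hc₁
  have hc₁0 : 0 < c₁ := by positivity
  have hnear : ∀ t : ℝ, |t| ≤ Real.pi / b →
      ‖pgf ν (Complex.exp (t * Complex.I))‖ ≤ Real.exp (-(c₁ * t ^ 2)) := by
    intro t ht
    refine (norm_pgf_circle_le ν hb t).trans (Real.exp_le_exp.2 (neg_le_neg ?_))
    rw [le_div_iff₀ hbR] at ht
    have h2 : |b * t| ≤ Real.pi := by
      rw [abs_mul, abs_of_pos hbR]; linarith
    have h3 := Real.cos_le_one_sub_mul_cos_sq h2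
    rw [hc₁, mul_assoc]
    refine mul_le_mul_of_nonneg_left ?_ (by positivity)
    rw [mul_assoc, ← mul_pow]
    linarith
  set K : Set ℝ := Set.Icc (-(Real.pi / d)) (Real.pi / d) ∩ {t | Real.pi / b ≤ |t|}
  have hK : IsCompact K :=
    isCompact_Icc.inter_right (isClosed_le continuous_const continuous_abs)
  rcases K.eq_empty_or_nonempty with hKe | hKn
  · refine ⟨c₁, hc₁0, fun t ht => ?_⟩
    rcases le_or_gt |t| (Real.pi / b) with h | h
    · exact hnear t h
    · have : t ∈ K := ⟨abs_le.1 ht, h.le⟩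
      rw [hKe] at this
      exact absurd this (Set.notMem_empty t)
  · obtain ⟨t₀, ht₀, hmax⟩ := hK.exists_isMaxOn hKn
      ((continuous_pgf_circle ν).norm).continuousOn
    have hη := hlt t₀ (by
      rintro rfl
      have h : Real.pi / b ≤ |(0 : ℝ)| := ht₀.2
      rw [abs_zero] at h
      exact absurd h (not_le.2 (by positivity))) (abs_le.2 ht₀.1)
    set η := ‖pgf ν (Complex.exp (t₀ * Complex.I))‖
    -- Chosen so that `c t² ≤ 1 - η` on the whole interval; then `η ≤ 1 - c t² ≤ exp (-c t²)`.
    have hc₂ : 0 < (1 - η) / (Real.pi / d) ^ 2 := div_pos (by linarith) (by positivity)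
    refine ⟨min c₁ ((1 - η) / (Real.pi / d) ^ 2), lt_min hc₁0 hc₂, fun t ht => ?_⟩
    rcases le_or_gt |t| (Real.pi / b) with h | h
    · refine (hnear t h).trans (Real.exp_le_exp.2 (neg_le_neg ?_))
      exact mul_le_mul_of_nonneg_right (min_le_left _ _) (sq_nonneg t)
    · have h1 : ‖pgf ν (Complex.exp (t * Complex.I))‖ ≤ η :=
        hmax (show t ∈ K from ⟨abs_le.1 ht, h.le⟩)
      have h2 : min c₁ ((1 - η) / (Real.pi / d) ^ 2) * t ^ 2 ≤ 1 - η := by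
        calc _ ≤ (1 - η) / (Real.pi / d) ^ 2 * (Real.pi / d) ^ 2 := by
              refine mul_le_mul (min_le_right _ _) ?_ (sq_nonneg t) hc₂.le
              exact sq_le_sq' (abs_le.1 ht).1 (abs_le.1 ht).2
          _ = 1 - η := div_mul_cancel₀ _ (by positivity)
      have h3 := Real.add_one_le_exp (-(min c₁ ((1 - η) / (Real.pi / d) ^ 2) * t ^ 2))
      linarith

/-- The central limit theorem for the standardised offspring number, with its characteristic
function written through `pgf`. -/
theorem tendsto_pgf_circle_pow (hL2 : MemLp (fun m : ℕ => (m : ℝ)) 2 ν)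
    (hmean : ∫ m, (m : ℝ) ∂ν = 1) (hvar : 0 < variance (fun m : ℕ => (m : ℝ)) ν) (s : ℝ) :
    Filter.Tendsto (fun n : ℕ =>
      (Complex.exp (-((s / (√(variance (fun m : ℕ => (m : ℝ)) ν) * √n) : ℝ) * Complex.I)) *
        pgf ν (Complex.exp ((s / (√(variance (fun m : ℕ => (m : ℝ)) ν) * √n) : ℝ) * Complex.I))) ^ n)
      Filter.atTop (nhds (Complex.exp (-s ^ 2 / 2))) := by
  set v := variance (fun m : ℕ => (m : ℝ)) ν with hv
  have hint : Integrable (fun m : ℕ => (m : ℝ)) ν := hL2.integrable (by norm_num)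
  have hX0 : ∫ m : ℕ, (√v)⁻¹ * ((m : ℝ) - 1) ∂ν = 0 := by
    rw [integral_const_mul, integral_sub hint (integrable_const _), hmean]
    simp
  have hX1 : ∫ m : ℕ, ((√v)⁻¹ * ((m : ℝ) - 1)) ^ 2 ∂ν = 1 := by
    simp only [mul_pow]
    rw [integral_const_mul, inv_pow, Real.sq_sqrt hvar.le]
    rw [variance_eq_integral hL2.aestronglyMeasurable.aemeasurable, hmean] at hv
    rw [← hv, inv_mul_cancel₀ hvar.ne']
  have h := tendsto_charFun_inv_sqrt_mul_pow (P := ν)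
    (X := fun m : ℕ => (√v)⁻¹ * ((m : ℝ) - 1)) (by fun_prop) hX0 hX1 s
  convert h using 3 with n
  rw [charFun_apply_real, integral_map (by fun_prop) (by fun_prop), pgf_eq_integral ν (by
    rw [Complex.norm_exp_ofReal_mul_I]), ← integral_const_mul]
  refine integral_congr_ae (Filter.Eventually.of_forall fun m => ?_)
  dsimp only
  rw [← Complex.exp_nat_mul, ← Complex.exp_add]
  congr 1
  push_cast
  rw [div_eq_mul_inv, mul_inv]
  ring

/-- The lower bound of the local central limit theorem, at distance one from the mean. -/
theorem exists_le_coeff_pow (hL2 : MemLp (fun m : ℕ => (m : ℝ)) 2 ν)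
    (hmean : ∫ m, (m : ℝ) ∂ν = 1) (hvar : 0 < variance (fun m : ℕ => (m : ℝ)) ν) :
    ∃ c : ℝ, 0 < c ∧ ∀ n : ℕ, 1 ≤ n → PowerSeries.coeff (n - 1) (offspringSeries ν ^ n) ≠ 0 →
      c ≤ √n * PowerSeries.coeff (n - 1) (offspringSeries ν ^ n) := by
  obtain ⟨b, hb, hνb⟩ := exists_pos_atom ν (hL2.integrable (by norm_num)) hmean
  have hν0 := zero_atom_pos ν hL2 hmean hvar
  obtain ⟨d, hd, hdvd, hspan⟩ := exists_span ν hb hνb.ne'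
  obtain ⟨c, hc, hdecay⟩ := exists_norm_pgf_circle_le ν hν0 hb hνb hd hspan
  have hpow : ∀ N j, PowerSeries.coeff j (offspringSeries ν ^ N) ≠ 0 → d ∣ j := fun N j =>
    dvd_of_coeff_pow_ne_zero fun j hj => hdvd j (by rwa [← coeff_offspringSeries])
  have htend := tendsto_pgf_circle_pow ν hL2 hmean hvar
  set v := variance (fun m : ℕ => (m : ℝ)) ν
  have hdR : (0 : ℝ) < d := by exact_mod_cast hd
  have hsv : 0 < √v := Real.sqrt_pos.2 hvar
  have hpi := Real.pi_pos
  set w : ℕ → ℝ := fun n => √v * √n with hw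
  set h : ℕ → ℝ → ℂ := fun n t =>
    pgf ν (Complex.exp (t * Complex.I)) ^ n * Complex.exp (-((n - 1 : ℕ) * t * Complex.I)) with hh
  have hw0 : ∀ n, 1 ≤ n → 0 < w n := fun n hn =>
    mul_pos hsv (Real.sqrt_pos.2 (by exact_mod_cast hn))
  have hhc : ∀ n, Continuous (h n) := fun n =>
    ((continuous_pgf_circle ν).pow n).mul (by fun_prop)
  have hhn : ∀ n t, ‖h n t‖ = ‖pgf ν (Complex.exp (t * Complex.I))‖ ^ n := by
    intro n t
    have : ‖Complex.exp (-((n - 1 : ℕ) * t * Complex.I))‖ = 1 := by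
      rw [Complex.exp_neg, norm_inv, inv_eq_one]
      exact_mod_cast Complex.norm_exp_ofReal_mul_I ((n - 1 : ℕ) * t)
    simp only [hh]
    rw [norm_mul, this, mul_one, norm_pow]
  set S : ℕ → Set ℝ := fun n => Set.Ioc (-(w n * (Real.pi / d))) (w n * (Real.pi / d)) with hS
  -- The inversion integrand after the substitution `t = s / w n`, extended by zero so that
  -- dominated convergence works on the whole line.
  set F : ℕ → ℝ → ℂ := fun n => (S n).indicator fun s => h n (s / w n) with hF
  have hlim : Filter.Tendsto (fun n => ∫ s, F n s) Filter.atTop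
      (nhds (∫ s : ℝ, Complex.exp (-s ^ 2 / 2))) := by
    refine tendsto_integral_filter_of_dominated_convergence
      (fun s => Real.exp (-(c / v) * s ^ 2)) ?_ ?_ (integrable_exp_neg_mul_sq (by positivity)) ?_
    · refine Filter.Eventually.of_forall fun n => ?_
      exact (((hhc n).comp (continuous_id.div_const _)).aestronglyMeasurable).indicator
        measurableSet_Ioc
    · filter_upwards [Filter.eventually_ge_atTop 1] with n hn
      refine Filter.Eventually.of_forall fun s => ?_
      by_cases hs : s ∈ S n
      · have hn0 : (0 : ℝ) < n := by exact_mod_cast hn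
        simp only [hF]
        rw [Set.indicator_of_mem hs, hhn]
        have habs : |s / w n| ≤ Real.pi / d := by
          rw [abs_div, abs_of_pos (hw0 n hn), div_le_iff₀ (hw0 n hn), mul_comm]
          exact abs_le.2 ⟨hs.1.le, hs.2⟩
        refine (pow_le_pow_left₀ (norm_nonneg _) (hdecay _ habs) n).trans (le_of_eq ?_)
        rw [← Real.exp_nat_mul]
        congr 1
        rw [div_pow, hw]
        simp only [mul_pow]
        rw [Real.sq_sqrt hvar.le, Real.sq_sqrt hn0.le]
        field_simp
      · simp only [hF]
        rw [Set.indicator_of_notMem hs, norm_zero]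
        exact (Real.exp_pos _).le
    · refine Filter.Eventually.of_forall fun s => ?_
      have hwt : Filter.Tendsto w Filter.atTop Filter.atTop :=
        (Real.tendsto_sqrt_atTop.comp tendsto_natCast_atTop_atTop).const_mul_atTop hsv
      -- The target is `n - 1` and not the mean `n`; the difference is one phase factor, which tends
      -- to one.
      have hphase : Filter.Tendsto (fun n => Complex.exp ((s / w n : ℝ) * Complex.I)) Filter.atTop
          (nhds 1) := by
        have h1 : Filter.Tendsto (fun n => s / w n) Filter.atTop (nhds 0) :=
          hwt.const_div_atTop s
        have h2 : Continuous fun x : ℝ => Complex.exp (x * Complex.I) := by fun_prop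
        have h3 := (h2.tendsto 0).comp h1
        simp only [Complex.ofReal_zero, zero_mul, Complex.exp_zero] at h3
        exact h3
      have hprod := (htend s).mul hphase
      rw [mul_one] at hprod
      refine hprod.congr' ?_
      filter_upwards [Filter.eventually_ge_atTop 1,
        (hwt.atTop_mul_const (show 0 < Real.pi / d by positivity)).eventually_gt_atTop |s|]
        with n hn hns
      have hs : s ∈ S n := ⟨(abs_lt.1 hns).1, (abs_lt.1 hns).2.le⟩
      simp only [hF]
      rw [Set.indicator_of_mem hs]
      simp only [hh]
      rw [mul_pow, mul_right_comm, ← Complex.exp_nat_mul, ← Complex.exp_add, mul_comm]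
      congr 2
      rw [Nat.cast_sub hn]
      simp only [hw]
      push_cast
      ring
  have hgauss : ‖∫ s : ℝ, Complex.exp (-s ^ 2 / 2)‖ = √(2 * Real.pi) := by
    have : ∀ s : ℝ, Complex.exp (-s ^ 2 / 2) = ((Real.exp (-(1 / 2) * s ^ 2) : ℝ) : ℂ) := by
      intro s
      push_cast
      congr 1
      ring
    simp only [this]
    rw [integral_complex_ofReal, integral_gaussian, Complex.norm_real,
      Real.norm_of_nonneg (Real.sqrt_nonneg _)]
    congr 1
    ring
  -- Divisibility places `n - 1` in the lattice carrying `S_n`, so integrating over `[-π/d, π/d]`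
  -- recovers the coefficient.
  have hval : ∀ n, 1 ≤ n → d ∣ n - 1 → ‖∫ s, F n s‖ =
      √v * (2 * Real.pi / d) * (√n * PowerSeries.coeff (n - 1) (offspringSeries ν ^ n)) := by
    intro n hn hdn
    have hwn := hw0 n hn
    have h1 := integral_pgf_pow ν one_pos le_rfl hd (N := n) (M := n - 1) (fun j hj => by
      obtain ⟨k, hk⟩ := hpow n j hj
      obtain ⟨l, hl⟩ := hdn
      exact ⟨k - l, by rw [hk, hl]; push_cast; ring⟩)
    simp only [Complex.ofReal_one, one_mul, one_pow, mul_one] at h1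
    have h2 : ∫ s, F n s = (w n : ℂ) * (2 * Real.pi / d *
        ((PowerSeries.coeff (n - 1) (offspringSeries ν ^ n) : ℝ) : ℂ)) := by
      rw [← h1]
      simp only [hF, hS]
      rw [integral_indicator measurableSet_Ioc,
        ← intervalIntegral.integral_of_le (by linarith [show 0 < w n * (Real.pi / d) by positivity]),
        intervalIntegral.integral_comp_div (fun t => h n t) hwn.ne', neg_div,
        mul_div_cancel_left₀ _ hwn.ne', Complex.real_smul]
    rw [h2]
    have h3 : (w n : ℂ) * (2 * Real.pi / d *
        ((PowerSeries.coeff (n - 1) (offspringSeries ν ^ n) : ℝ) : ℂ)) =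
        ((√v * (2 * Real.pi / d) * (√n * PowerSeries.coeff (n - 1) (offspringSeries ν ^ n)) : ℝ) :
          ℂ) := by
      simp only [hw]
      push_cast
      ring
    rw [h3, Complex.norm_real, Real.norm_of_nonneg]
    have := coeff_offspringSeries_pow_nonneg ν n (n - 1)
    positivity
  have hev : ∀ᶠ n in Filter.atTop, √(2 * Real.pi) / 2 < ‖∫ s, F n s‖ := by
    refine hlim.norm.eventually_const_lt ?_
    rw [hgauss]
    exact half_lt_self (Real.sqrt_pos.2 (by positivity))
  obtain ⟨n₀, hn₀⟩ := Filter.eventually_atTop.1 hev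
  -- The finitely many `n` below the asymptotic regime are covered by their least positive value.
  obtain ⟨c', hc', hsmall⟩ := exists_pos_le_of_pos
    (fun n => √n * PowerSeries.coeff (n - 1) (offspringSeries ν ^ n)) n₀
  refine ⟨min c' (√(2 * Real.pi) / 2 / (√v * (2 * Real.pi / d))),
    lt_min hc' (by positivity), fun n hn hne => ?_⟩
  rcases lt_or_ge n n₀ with hlt | hge
  · refine (min_le_left _ _).trans (hsmall n hlt ?_)
    exact mul_pos (Real.sqrt_pos.2 (by exact_mod_cast hn))
      (lt_of_le_of_ne (coeff_offspringSeries_pow_nonneg ν _ _) hne.symm)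
  · refine (min_le_right _ _).trans ?_
    have := (hn₀ n hge).le
    rw [hval n hn (hpow n _ hne)] at this
    rw [div_le_iff₀ (by positivity)]
    linarith

end GaltonWatson

/-! ### Moments of the generation sizes -/

namespace GaltonWatson

section

variable (ν : Measure ℕ) [IsProbabilityMeasure ν]

/-- Three of the powers of `z` pay for the `N^(-3/2)` in the Otter-Dwass formula and the point
probability. The linear factor `z` on the right is kept so that `E Z_k = 1` can be used uniformly in
`k`. -/
theorem exists_pow_mul_coeff_sizeSeries_le (hL2 : MemLp (fun m : ℕ => (m : ℝ)) 2 ν)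
    (hmean : ∫ m, (m : ℝ) ∂ν = 1) (hvar : 0 < variance (fun m : ℕ => (m : ℝ)) ν) (m : ℕ) :
    ∃ K : ℝ, 0 < K ∧ ∀ N z : ℕ, (z : ENNReal) ^ (m + 3) * PowerSeries.coeff N (sizeSeries ν ^ z) ≤
      ENNReal.ofReal (K * √N ^ m) * z := by
  obtain ⟨C, hC, hle⟩ := exists_coeff_pow_le ν hL2 hmean hvar
  refine ⟨C * (m + 3).factorial, by positivity, fun N z => ?_⟩
  rcases Nat.eq_zero_or_pos z with rfl | hz
  · simp
  rcases Nat.eq_zero_or_pos N with rfl | hN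
  · have : PowerSeries.coeff 0 (sizeSeries ν ^ z) = 0 := by
      have h0 := coeff_zero_sizeSeries ν
      rw [PowerSeries.coeff_zero_eq_constantCoeff_apply] at h0 ⊢
      rw [map_pow, h0, zero_pow hz.ne']
    simp [this]
  have hN0 : (0 : ℝ) < N := by exact_mod_cast hN
  have hsN : 0 < √(N : ℝ) := Real.sqrt_pos.2 hN0
  have hN' : (N : ENNReal) ≠ 0 := by exact_mod_cast hN.ne'
  rw [← ENNReal.mul_le_mul_iff_right hN' (ENNReal.natCast_ne_top N), mul_left_comm,
    natCast_mul_coeff_sizeSeries_pow]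
  split_ifs with hzN
  swap
  · simp
  have hp := hle N (N - z) hN
  rw [Nat.cast_sub hzN, sub_sub_cancel] at hp
  -- One term of the exponential series; it cancels against the tail factor `exp (-z/√N)`.
  have hx : ((z : ℝ) / √N) ^ (m + 3) ≤ (m + 3).factorial * Real.exp (z / √N) := by
    have := Real.pow_div_factorial_le_exp (x := (z : ℝ) / √N) (by positivity) (m + 3)
    rwa [div_le_iff₀ (by positivity), mul_comm] at this
  have hreal : (z : ℝ) ^ (m + 3) * PowerSeries.coeff (N - z) (offspringSeries ν ^ N) ≤
      N * (C * (m + 3).factorial * √N ^ m) := by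
    calc (z : ℝ) ^ (m + 3) * PowerSeries.coeff (N - z) (offspringSeries ν ^ N)
        ≤ (z : ℝ) ^ (m + 3) * (C / √N * Real.exp (-(z / √N))) := by gcongr
      _ = ((z : ℝ) / √N) ^ (m + 3) * Real.exp (-(z / √N)) * (C * (√N ^ 2 * √N ^ m)) := by
          rw [div_pow, pow_add (√(N : ℝ))]
          field_simp
      _ ≤ (m + 3).factorial * Real.exp (z / √N) * Real.exp (-(z / √N)) *
            (C * (√N ^ 2 * √N ^ m)) := by gcongr
      _ = _ := by
          rw [Real.sq_sqrt hN0.le, Real.exp_neg]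
          field_simp
  calc (z : ENNReal) ^ (m + 3) * (z * ENNReal.ofReal
        (PowerSeries.coeff (N - z) (offspringSeries ν ^ N)))
      = ENNReal.ofReal ((z : ℝ) ^ (m + 3) *
          PowerSeries.coeff (N - z) (offspringSeries ν ^ N)) * z := by
        rw [ENNReal.ofReal_mul (by positivity), ENNReal.ofReal_pow (by positivity),
          ENNReal.ofReal_natCast]
        ring
    _ ≤ ENNReal.ofReal (N * (C * (m + 3).factorial * √N ^ m)) * z := by gcongr
    _ = _ := by
        rw [ENNReal.ofReal_mul (by positivity), ENNReal.ofReal_natCast]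
        ring

theorem exists_lintegral_generationSize_pow_le (hL2 : MemLp (fun m : ℕ => (m : ℝ)) 2 ν)
    (hmean : ∫ m, (m : ℝ) ∂ν = 1) (hvar : 0 < variance (fun m : ℕ => (m : ℝ)) ν) (m : ℕ) :
    ∃ K : ℝ, 0 < K ∧ ∀ k n : ℕ,
      ∫⁻ c in {c | treeSize c = (n : ℕ∞)}, (generationSize k c : ENNReal) ^ (m + 3) ∂(gwLaw ν) ≤
        ENNReal.ofReal (K * √n ^ m) := by
  obtain ⟨K, hK, hle⟩ := exists_pow_mul_coeff_sizeSeries_le ν hL2 hmean hvar m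
  refine ⟨K, hK, fun k n => ?_⟩
  have hmean' : ∫⁻ j, (j : ENNReal) ∂ν = 1 := by
    have h := ofReal_integral_eq_lintegral_ofReal (hL2.integrable (by norm_num))
      (Filter.Eventually.of_forall fun m : ℕ => Nat.cast_nonneg (α := ℝ) m)
    rw [hmean, ENNReal.ofReal_one] at h
    simpa using h.symm
  rw [lintegral_generationSize_pow_indicator]
  calc _ ≤ ∫⁻ c, ENNReal.ofReal (K * √n ^ m) * generationSize k c ∂(gwLaw ν) := by
        refine lintegral_mono fun c => ?_
        dsimp only
        split_ifs with h
        · refine (hle _ _).trans ?_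
          gcongr
          exact Nat.sub_le _ _
        · simp
    _ = ENNReal.ofReal (K * √n ^ m) := by
        rw [lintegral_const_mul' _ _ ENNReal.ofReal_ne_top, lintegral_generationSize ν hmean',
          mul_one]

/-- The Otter-Dwass formula with one tree, `n P(|𝒯| = n) = P(S_n = n - 1)`, followed by the local
lower bound. -/
theorem exists_le_gwLaw_treeSize_eq (hL2 : MemLp (fun m : ℕ => (m : ℝ)) 2 ν)
    (hmean : ∫ m, (m : ℝ) ∂ν = 1) (hvar : 0 < variance (fun m : ℕ => (m : ℝ)) ν) :
    ∃ c : ℝ, 0 < c ∧ ∀ n : ℕ, 1 ≤ n → 0 < gwLaw ν {c | treeSize c = (n : ℕ∞)} →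
      ENNReal.ofReal (c / √n ^ 3) ≤ gwLaw ν {c | treeSize c = (n : ℕ∞)} := by
  obtain ⟨c, hc, hle⟩ := exists_le_coeff_pow ν hL2 hmean hvar
  refine ⟨c, hc, fun n hn hpos => ?_⟩
  have hn0 : (0 : ℝ) < n := by exact_mod_cast hn
  have hsn : 0 < √(n : ℝ) := Real.sqrt_pos.2 hn0
  have hn' : (n : ENNReal) ≠ 0 := by exact_mod_cast (Nat.one_le_iff_ne_zero.1 hn)
  have h := natCast_mul_coeff_sizeSeries_pow ν n 1
  rw [pow_one, sizeSeries, PowerSeries.coeff_mk, if_pos hn, Nat.cast_one, one_mul] at h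
  have hne : PowerSeries.coeff (n - 1) (offspringSeries ν ^ n) ≠ 0 := by
    intro h0
    rw [h0, ENNReal.ofReal_zero] at h
    exact (mul_ne_zero hn' hpos.ne') h
  rw [← ENNReal.mul_le_mul_iff_right hn' (ENNReal.natCast_ne_top n), h, ← ENNReal.ofReal_natCast,
    ← ENNReal.ofReal_mul hn0.le]
  refine ENNReal.ofReal_le_ofReal ?_
  have h1 := hle n hn hne
  have h2 : (n : ℝ) * (c / √n ^ 3) = c / √n := by
    rw [pow_succ, Real.sq_sqrt hn0.le]
    field_simp
  rw [h2, div_le_iff₀ hsn]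
  linarith

theorem exists_lintegral_generationSize_pow_condGWLaw_le
    (hL2 : MemLp (fun m : ℕ => (m : ℝ)) 2 ν)
    (hmean : ∫ m, (m : ℝ) ∂ν = 1) (hvar : 0 < variance (fun m : ℕ => (m : ℝ)) ν) (m : ℕ) :
    ∃ K : ℝ, 0 < K ∧ ∀ k n : ℕ, 1 ≤ n → 0 < gwLaw ν {c | treeSize c = (n : ℕ∞)} →
      ∫⁻ c, (generationSize k c : ENNReal) ^ (m + 3) ∂(condGWLaw ν n) ≤
        ENNReal.ofReal (K * √n ^ (m + 3)) := by
  obtain ⟨K, hK, hup⟩ := exists_lintegral_generationSize_pow_le ν hL2 hmean hvar m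
  obtain ⟨c, hc, hlow⟩ := exists_le_gwLaw_treeSize_eq ν hL2 hmean hvar
  refine ⟨K / c, by positivity, fun k n hn hpos => ?_⟩
  have hn0 : (0 : ℝ) < n := by exact_mod_cast hn
  have hsn : 0 < √(n : ℝ) := Real.sqrt_pos.2 hn0
  rw [condGWLaw, ProbabilityTheory.cond, lintegral_smul_measure, smul_eq_mul, mul_comm, ← div_eq_mul_inv]
  refine ENNReal.div_le_of_le_mul ((hup k n).trans ?_)
  refine le_trans (le_of_eq ?_) (mul_le_mul_right (hlow n hn hpos) _)
  rw [← ENNReal.ofReal_mul (by positivity)]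
  congr 1
  rw [pow_add]
  field_simp

end

end GaltonWatson

theorem lemma2p4 (ν : MeasureTheory.Measure ℕ) [MeasureTheory.IsProbabilityMeasure ν]
    (hL2 : MeasureTheory.MemLp (fun m : ℕ => (m : ℝ)) 2 ν)
    (hmean : ∫ m, (m : ℝ) ∂ν = 1)
    (hvar : 0 < ProbabilityTheory.variance (fun m : ℕ => (m : ℝ)) ν)
    (r : ℝ) (hr : 0 < r) :
    ∃ C : ℝ, 0 < C ∧ ∀ k n : ℕ, 1 ≤ n →
      0 < GaltonWatson.gwLaw ν {c | GaltonWatson.treeSize c = (n : ℕ∞)} →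
      MeasureTheory.Integrable
        (fun c => (GaltonWatson.generationSize k c : ℝ) ^ r) (GaltonWatson.condGWLaw ν n) ∧
      ∫ c, (GaltonWatson.generationSize k c : ℝ) ^ r ∂(GaltonWatson.condGWLaw ν n)
        ≤ C * (n : ℝ) ^ (r / 2) := by

  -- The integer moment used for comparison has order `p + 3 ≥ r`.
  obtain ⟨p, hp⟩ := exists_nat_ge r
  obtain ⟨K, hK, hle⟩ :=
    GaltonWatson.exists_lintegral_generationSize_pow_condGWLaw_le ν hL2 hmean hvar p
  refine ⟨1 + K, by positivity, fun k n hn hpos => ?_⟩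
  have hprob : IsProbabilityMeasure (GaltonWatson.condGWLaw ν n) :=
    cond_isProbabilityMeasure hpos.ne'
  have hn0 : (0 : ℝ) < n := by exact_mod_cast hn
  have hsn : 0 < √(n : ℝ) := Real.sqrt_pos.2 hn0
  have hZ := GaltonWatson.measurable_generationSize k
  have hlint : ∫⁻ c, ENNReal.ofReal ((GaltonWatson.generationSize k c : ℝ) ^ (p + 3))
      ∂(GaltonWatson.condGWLaw ν n) ≤ ENNReal.ofReal (K * √n ^ (p + 3)) := by
    refine le_trans (le_of_eq (lintegral_congr fun c => ?_)) (hle k n hn hpos)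
    rw [ENNReal.ofReal_pow (by positivity), ENNReal.ofReal_natCast]
  have hmeas : ∀ f : ℕ → ℝ, AEStronglyMeasurable
      (fun c => f (GaltonWatson.generationSize k c)) (GaltonWatson.condGWLaw ν n) := fun f =>
    (measurable_from_top.comp hZ).aestronglyMeasurable
  have hnn : ∀ c, (0 : ℝ) ≤ (GaltonWatson.generationSize k c : ℝ) ^ (p + 3) := fun c => by positivity
  have hint : Integrable (fun c => (GaltonWatson.generationSize k c : ℝ) ^ (p + 3))
      (GaltonWatson.condGWLaw ν n) := by
    refine ⟨hmeas fun z => (z : ℝ) ^ (p + 3), ?_⟩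
    rw [hasFiniteIntegral_iff_ofReal (Filter.Eventually.of_forall hnn)]
    exact hlint.trans_lt ENNReal.ofReal_lt_top
  have hle' : ∫ c, (GaltonWatson.generationSize k c : ℝ) ^ (p + 3) ∂(GaltonWatson.condGWLaw ν n) ≤
      K * √n ^ (p + 3) := by
    rw [integral_eq_lintegral_of_nonneg_ae (Filter.Eventually.of_forall hnn) hint.1]
    exact ENNReal.toReal_le_of_le_ofReal (by positivity) hlint
  have hpt : ∀ c, (GaltonWatson.generationSize k c : ℝ) ^ r ≤
      (n : ℝ) ^ (r / 2) * (1 + (√n ^ (p + 3))⁻¹ * (GaltonWatson.generationSize k c : ℝ) ^ (p + 3)) := by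
    intro c
    set z : ℝ := (GaltonWatson.generationSize k c : ℝ)
    have hz : 0 ≤ z := Nat.cast_nonneg _
    have hx : 0 ≤ z / √n := by positivity
    -- After normalisation by `√n`, values up to one are bounded by `1` and larger ones by the
    -- higher power, which yields the constant `1 + K`.
    have h1 : (z / √n) ^ r ≤ 1 + (z / √n) ^ (p + 3) := by
      rcases le_total (z / √n) 1 with h | h
      · exact (Real.rpow_le_one hx h hr.le).trans (le_add_of_nonneg_right (by positivity))
      · have : (z / √n) ^ r ≤ (z / √n) ^ ((p + 3 : ℕ) : ℝ) :=
          Real.rpow_le_rpow_of_exponent_le h (by push_cast; linarith)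
        rw [Real.rpow_natCast] at this
        linarith
    have h2 : z ^ r = (n : ℝ) ^ (r / 2) * (z / √n) ^ r := by
      have h3 : (n : ℝ) ^ (r / 2) = √n ^ r := by
        rw [Real.sqrt_eq_rpow, ← Real.rpow_mul hn0.le]
        congr 1
        ring
      rw [h3, ← Real.mul_rpow hsn.le hx, mul_div_cancel₀ _ hsn.ne']
    rw [h2]
    refine mul_le_mul_of_nonneg_left (h1.trans_eq ?_) (by positivity)
    rw [div_pow, div_eq_inv_mul]
  have hint' : Integrable (fun c => (n : ℝ) ^ (r / 2) *
      (1 + (√n ^ (p + 3))⁻¹ * (GaltonWatson.generationSize k c : ℝ) ^ (p + 3)))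
      (GaltonWatson.condGWLaw ν n) :=
    ((integrable_const 1).add (hint.const_mul _)).const_mul _
  have hnr : ∀ c, (0 : ℝ) ≤ (GaltonWatson.generationSize k c : ℝ) ^ r := fun c =>
    Real.rpow_nonneg (Nat.cast_nonneg _) r
  refine ⟨hint'.mono' (hmeas fun z => (z : ℝ) ^ r) (Filter.Eventually.of_forall fun c => ?_), ?_⟩
  · rw [Real.norm_of_nonneg (hnr c)]
    exact hpt c
  · refine (integral_mono_of_nonneg (Filter.Eventually.of_forall hnr) hint'
      (Filter.Eventually.of_forall hpt)).trans ?_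
    rw [integral_const_mul, integral_add (integrable_const 1) (hint.const_mul _),
      integral_const_mul, mul_comm]
    refine mul_le_mul_of_nonneg_right ?_ (by positivity)
    have h1 : (√n ^ (p + 3))⁻¹ * ∫ c, (GaltonWatson.generationSize k c : ℝ) ^ (p + 3)
        ∂(GaltonWatson.condGWLaw ν n) ≤ K := by
      rw [inv_mul_le_iff₀ (by positivity), mul_comm]
      exact hle'
    simpa using h1
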